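/- Let $F$ be a field with $\operatorname{char} F\neq 2$, let $\sigma\colon x\mapsto\bar x$ be an automorphism of $F$ with $\sigma^2=\mathrm{id}\neq\sigma$, and let $(V,h)$ be a non-degenerate $\sigma$-hermitian space of dimension $4$ over $F$ (with $h$ linear in the right and $\sigma$-semilinear in the left variable). Fix a basis $e_1,\dots,e_4$ of $V$ with Gram matrix $H=(h(e_i,e_k))$, and a linear isomorphism $b\colon\bigwedge^4V\to F$. On $\bigwedge^2V$ consider the Pfaffian form $\mathrm{Pf}(x,y)=b(x\wedge y)$, the hermitian form $\bigwedge^2h$ determined by $\bigwedge^2h(x_1\wedge x_2,y_1\wedge y_2)=\det(h(x_i,y_k))$, and the Hodge operator $J$, i.e. the $\sigma$-semilinear map with $\mathrm{Pf}(J(x),y)=\bigwedge^2h(x,y)$ for all $x,y$. Let $\delta=\det H/(\bar\beta\beta)$ with $\beta=b(e_1\wedge e_2\wedge e_3\wedge e_4)$, and let $K$ be the ring of all matrices $\begin{pmatrix}x_0&\delta\bar x_1\\x_1&\bar x_0\end{pmatrix}$ with $x_0,x_1\in F$. Identify $x_0\in F$ with $\begin{pmatrix}x_0&0\\0&\bar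 x_0\end{pmatrix}$ and put $j=\begin{pmatrix}0&\delta\\1&0\end{pmatrix}$, so that $K=F\oplus jF$. Then $J^2=\delta\,\mathrm{id}$, the space $\bigwedge^2V$ is a right $K$-module via $x(x_0+jx_1)=x\,x_0+J(x)\,x_1$, and $g(x,y)=\bigwedge^2h(x,y)+j\,\mathrm{Pf}(x,y)$ is a form on it with values in $K$ that is hermitian with respect to the involution $\alpha(x_0+jx_1)=\bar x_0+jx_1$ of $K$. Let $U(\bigwedge^2V,g)$ be the group of all $K$-linear isometries of $g$, and let $\eta\colon SU(V,h)\to U(\bigwedge^2V,g)$ be the homomorphism $\gamma\mapsto\bigwedge^2\gamma$. An Eichler transformation of $(\bigwedge^2V,g)$ is a map $\Sigma_{z,w,p}\colon x\mapsto x+z\,g(w,x)-(w+zp)\,g(z,x)$ with $z,w\in\bigwedge^2V$ and $p\in K$ such that $g(z,z)=0=g(z,w)$ and $\alpha(p)+p=g(w,w)$; it is called an isotropic transvection if $w=0$. Let $EU(\bigwedge^2V,g)$ be the subgroup of $U(\bigwedge^2V,g)$ generated by all Eichler transformations. Assume that $h$ is isotropic and that $K$ is not split, i.e. has no divisors of zero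 (together these two assumptions say that $h$ has Witt index $1$). Then $\eta(SU(V,h))=EU(\bigwedge^2V,g)$, and this group is generated by the isotropic transvections of $(\bigwedge^2V,g)$. -/

import Mathlib

open Module

noncomputable section

universe u v w

/-- The additive group `N` on which a scalar `s` acts as `σ s` does on the module `N`; an
`F`-linear map into `Twist σ N` is the same thing as a `σ`-semilinear map into `N`. -/
def Twist {F : Type u} [Field F] (_σ : F →+* F) (N : Type w) : Type w := N

instance {F : Type u} [Field F] (σ : F →+* F) (N : Type w) [AddCommGroup N] :
    AddCommGroup (Twist σ N) := inferInstanceAs (AddCommGroup N)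

instance {F : Type u} [Field F] (σ : F →+* F) (N : Type w) [AddCommGroup N] [Module F N] :
    Module F (Twist σ N) :=
  (Module.compHom N σ : Module F N)

theorem semilinear_update {V : Type v} {N : Type w} {n : ℕ} [DecidableEq (Fin n)] (f : V → N)
    (v : Fin n → V) (i : Fin n) (z : V) :
    (fun k => f (Function.update v i z k)) = Function.update (fun k => f (v k)) i (f z) := by
  ext k
  by_cases hk : k = i
  · subst hk; simp
  · simp [hk]

/-- The `n`-th exterior power of a semilinear map, on the universal alternating map. -/
def semilinearAlternating {F : Type u} [Field F] {σ : F →+* F} {V : Type v} {N : Type w}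
    [AddCommGroup V] [Module F V] [AddCommGroup N] [Module F N] (n : ℕ) (f : V →ₛₗ[σ] N) :
    V [⋀^Fin n]→ₗ[F] Twist σ (⋀[F]^n N) where
  toFun v := exteriorPower.ιMulti F n (fun i => f (v i))
  map_update_add' := by
    intro _ v i x y
    rw [semilinear_update, semilinear_update, semilinear_update, map_add]
    exact (exteriorPower.ιMulti F n).map_update_add (fun k => f (v k)) i (f x) (f y)
  map_update_smul' := by
    intro _ v i s x
    rw [semilinear_update, semilinear_update, map_smulₛₗ]
    exact (exteriorPower.ιMulti F n).map_update_smul (fun k => f (v k)) i (σ s) (f x)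
  map_eq_zero_of_eq' := by
    intro v i j hv hij
    exact (exteriorPower.ιMulti F n).map_eq_zero_of_eq (fun k => f (v k)) (by simp [hv]) hij

/-- Functoriality of exterior powers for semilinear maps:
`v₁ ∧ ⋯ ∧ vₙ ↦ f v₁ ∧ ⋯ ∧ f vₙ`. -/
def exteriorPowerMapSemilinear {F : Type u} [Field F] {σ : F →+* F} {V : Type v} {N : Type w}
    [AddCommGroup V] [Module F V] [AddCommGroup N] [Module F N] (n : ℕ) (f : V →ₛₗ[σ] N) :
    ⋀[F]^n V →ₛₗ[σ] ⋀[F]^n N where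
  toFun := exteriorPower.alternatingMapLinearEquiv (semilinearAlternating n f)
  map_add' x y := map_add (exteriorPower.alternatingMapLinearEquiv (semilinearAlternating n f)) x y
  map_smul' s x :=
    map_smul (exteriorPower.alternatingMapLinearEquiv (semilinearAlternating n f)) s x

theorem exteriorPowerMapSemilinear_ιMulti {F : Type u} [Field F] {σ : F →+* F} {V : Type v}
    {N : Type w} [AddCommGroup V] [Module F V] [AddCommGroup N] [Module F N] (n : ℕ)
    (f : V →ₛₗ[σ] N) (v : Fin n → V) :
    exteriorPowerMapSemilinear n f (exteriorPower.ιMulti F n v) =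
      exteriorPower.ιMulti F n (fun i => f (v i)) :=
  exteriorPower.alternatingMapLinearEquiv_apply_ιMulti (semilinearAlternating n f) v

/-- The bilinear wedge product `⋀² V × ⋀² V → ⋀⁴ V`. -/
def wedgeTwoTwo (F : Type u) (V : Type v) [Field F] [AddCommGroup V] [Module F V] :
    ⋀[F]^2 V →ₗ[F] ⋀[F]^2 V →ₗ[F] ⋀[F]^4 V :=
  LinearMap.mk₂ F
    (fun x y => ⟨x.1 * y.1, SetLike.mul_mem_graded (A := fun n => ⋀[F]^n V) x.2 y.2⟩)
    (fun x x' y => Subtype.ext (by simp [add_mul]))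
    (fun s x y => Subtype.ext (by simp))
    (fun x y y' => Subtype.ext (by simp [mul_add]))
    (fun s x y => Subtype.ext (by simp))

theorem wedgeTwoTwo_ιMulti {F : Type u} {V : Type v} [Field F] [AddCommGroup V] [Module F V]
    (x y z t : V) :
    wedgeTwoTwo F V (exteriorPower.ιMulti F 2 ![x, y]) (exteriorPower.ιMulti F 2 ![z, t]) =
      exteriorPower.ιMulti F 4 ![x, y, z, t] := by
  apply Subtype.ext
  simp [wedgeTwoTwo, ExteriorAlgebra.ιMulti_apply, mul_assoc]

/-- A non-degenerate `σ`-hermitian space of dimension four over a field `F`, where `σ` is a field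
automorphism with `σ² = id`, together with a basis `e` and a linear isomorphism `b : ⋀⁴ V ≃ F`. The
form `h` is `σ`-semilinear in the left and linear in the right variable. -/
structure HermitianFourSpace (F : Type u) (V : Type v) [Field F] [AddCommGroup V] [Module F V] where
  σ : F →+* F
  σ_σ : ∀ s, σ (σ s) = s
  h : V →ₛₗ[σ] V →ₗ[F] F
  hermitian : ∀ x y, h y x = σ (h x y)
  nondegenerate : h.Nondegenerate
  e : Basis (Fin 4) F V
  b : ⋀[F]^4 V ≃ₗ[F] F

namespace HermitianFourSpace

variable {F : Type u} {V : Type v} [Field F] [AddCommGroup V] [Module F V]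
  (D : HermitianFourSpace F V)

/-- The hermitian form `⋀² h` on `⋀² V`. -/
def extH : ⋀[F]^2 V →ₛₗ[D.σ] ⋀[F]^2 V →ₗ[F] F :=
  (exteriorPower.pairingDual F V 2).comp (exteriorPowerMapSemilinear 2 D.h)

/-- The Pfaffian form `Pf(x, y) = b (x ∧ y)` on `⋀² V`. -/
def pf : ⋀[F]^2 V →ₗ[F] ⋀[F]^2 V →ₗ[F] F :=
  (wedgeTwoTwo F V).compr₂ D.b.toLinearMap

theorem extH_ιMulti (x y z t : V) :
    D.extH (exteriorPower.ιMulti F 2 ![x, y]) (exteriorPower.ιMulti F 2 ![z, t]) =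
      D.h x z * D.h y t - D.h x t * D.h y z := by
  simp [extH, exteriorPowerMapSemilinear_ιMulti, Matrix.det_fin_two]
  ring

/-- The value `b (e₁ ∧ e₂ ∧ e₃ ∧ e₄)`. -/
def volume : F := D.b (exteriorPower.ιMulti F 4 D.e)

theorem pf_ιMulti (x y z t : V) :
    D.pf (exteriorPower.ιMulti F 2 ![x, y]) (exteriorPower.ιMulti F 2 ![z, t]) =
      D.volume * D.e.det ![x, y, z, t] := by
  have key := AlternatingMap.eq_smul_basis_det D.e
    (D.b.toLinearMap.compAlternatingMap (exteriorPower.ιMulti F 4))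
  have := DFunLike.congr_fun key ![x, y, z, t]
  simpa [pf, wedgeTwoTwo_ιMulti, volume] using this

theorem volume_ne_zero : D.volume ≠ 0 := by
  intro hv
  have key := AlternatingMap.eq_smul_basis_det D.e
    (D.b.toLinearMap.compAlternatingMap (exteriorPower.ιMulti F 4))
  have hz : D.b.toLinearMap = 0 := by
    apply exteriorPower.linearMap_ext
    rw [key]
    ext x
    simp only [volume] at hv
    simp [hv]
  obtain ⟨x, hx⟩ := D.b.surjective 1
  have h1 : D.b.toLinearMap x = 1 := hx
  rw [hz] at h1
  simp at h1

/-- The bivector `e i ∧ e j`. -/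
def bivector (i j : Fin 4) : ⋀[F]^2 V := exteriorPower.ιMulti F 2 ![D.e i, D.e j]

theorem pf_bivector (x y : V) :
    D.pf (exteriorPower.ιMulti F 2 ![x, y]) (D.bivector 2 3) =
        D.volume * (D.e.repr x 0 * D.e.repr y 1 - D.e.repr x 1 * D.e.repr y 0) ∧
    D.pf (exteriorPower.ιMulti F 2 ![x, y]) (D.bivector 1 3) =
        - D.volume * (D.e.repr x 0 * D.e.repr y 2 - D.e.repr x 2 * D.e.repr y 0) ∧
    D.pf (exteriorPower.ιMulti F 2 ![x, y]) (D.bivector 1 2) =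
        D.volume * (D.e.repr x 0 * D.e.repr y 3 - D.e.repr x 3 * D.e.repr y 0) ∧
    D.pf (exteriorPower.ιMulti F 2 ![x, y]) (D.bivector 0 3) =
        D.volume * (D.e.repr x 1 * D.e.repr y 2 - D.e.repr x 2 * D.e.repr y 1) ∧
    D.pf (exteriorPower.ιMulti F 2 ![x, y]) (D.bivector 0 2) =
        - D.volume * (D.e.repr x 1 * D.e.repr y 3 - D.e.repr x 3 * D.e.repr y 1) ∧
    D.pf (exteriorPower.ιMulti F 2 ![x, y]) (D.bivector 0 1) =
        D.volume * (D.e.repr x 2 * D.e.repr y 3 - D.e.repr x 3 * D.e.repr y 2) := by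
  refine ⟨?_, ?_, ?_, ?_, ?_, ?_⟩ <;>
  · rw [bivector, pf_ιMulti]
    simp [Basis.det_apply, Matrix.det_succ_row_zero, Fin.sum_univ_succ, Basis.toMatrix_apply,
      Fin.succAbove]
    first | ring1 | (left; ring1)

theorem volume_smul (x : ⋀[F]^2 V) :
    D.volume • x =
      D.pf x (D.bivector 2 3) • D.bivector 0 1 - D.pf x (D.bivector 1 3) • D.bivector 0 2
      + D.pf x (D.bivector 1 2) • D.bivector 0 3 + D.pf x (D.bivector 0 3) • D.bivector 1 2
      - D.pf x (D.bivector 0 2) • D.bivector 1 3 + D.pf x (D.bivector 0 1) • D.bivector 2 3 := by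
  have key : D.volume • (LinearMap.id : ⋀[F]^2 V →ₗ[F] ⋀[F]^2 V) =
      (D.pf.flip (D.bivector 2 3)).smulRight (D.bivector 0 1)
      - (D.pf.flip (D.bivector 1 3)).smulRight (D.bivector 0 2)
      + (D.pf.flip (D.bivector 1 2)).smulRight (D.bivector 0 3)
      + (D.pf.flip (D.bivector 0 3)).smulRight (D.bivector 1 2)
      - (D.pf.flip (D.bivector 0 2)).smulRight (D.bivector 1 3)
      + (D.pf.flip (D.bivector 0 1)).smulRight (D.bivector 2 3) := by
    apply exteriorPower.linearMap_ext
    apply Basis.ext_alternating D.e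
    intro v hv
    obtain ⟨i, j, hij⟩ : ∃ i j, (fun k => D.e (v k)) = ![D.e i, D.e j] :=
      ⟨v 0, v 1, by ext k; fin_cases k <;> rfl⟩
    have hne : i ≠ j := by
      rintro rfl
      have h0 := congrFun hij 0
      have h1 := congrFun hij 1
      simp at h0 h1
      have := hv (D.e.injective (h0.trans h1.symm))
      simp at this
    rw [hij]
    obtain ⟨h1, h2, h3, h4, h5, h6⟩ := D.pf_bivector (D.e i) (D.e j)
    have swap : ∀ i j, D.bivector j i = - D.bivector i j := by
      intro i j
      have := (exteriorPower.ιMulti F 2).map_swap ![D.e i, D.e j] (i := 0) (j := 1) (by simp)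
      rw [bivector, bivector, ← this]
      congr 1
      ext k; fin_cases k <;> simp
    have hb : exteriorPower.ιMulti F 2 ![D.e i, D.e j] = D.bivector i j := rfl
    rw [hb] at h1 h2 h3 h4 h5 h6
    simp only [LinearMap.compAlternatingMap_apply, LinearMap.smul_apply, LinearMap.id_apply,
      LinearMap.add_apply, LinearMap.sub_apply, LinearMap.smulRight_apply, LinearMap.flip_apply,
      h1, h2, h3, h4, h5, h6, hb, Basis.repr_self]
    clear h1 h2 h3 h4 h5 h6 hb hij hv
    have s10 := swap 0 1
    have s20 := swap 0 2
    have s30 := swap 0 3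
    have s21 := swap 1 2
    have s31 := swap 1 3
    have s32 := swap 2 3
    fin_cases i <;> fin_cases j <;> first
      | exact absurd rfl hne
      | simp [s10, s20, s30, s21, s31, s32]
  exact LinearMap.congr_fun key x

theorem pf_injective : Function.Injective D.pf := by
  rw [injective_iff_map_eq_zero]
  intro x hx
  have := D.volume_smul x
  simpa [hx, D.volume_ne_zero] using this

/-- The isomorphism `⋀² V ≃ (⋀² V)ᵛ` given by the Pfaffian form. -/
def pfEquiv : ⋀[F]^2 V ≃ₗ[F] Module.Dual F (⋀[F]^2 V) :=
  haveI : FiniteDimensional F V := Module.Finite.of_basis D.e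
  LinearMap.linearEquivOfInjective D.pf D.pf_injective Subspace.dual_finrank_eq.symm

/-- The Hodge operator `J = Pf⁻¹ ∘ ⋀² h`. -/
def J : ⋀[F]^2 V →ₛₗ[D.σ] ⋀[F]^2 V :=
  D.pfEquiv.symm.toLinearMap.comp D.extH

theorem pf_J (x y : ⋀[F]^2 V) : D.pf (D.J x) y = D.extH x y :=
  LinearMap.congr_fun (D.pfEquiv.apply_symm_apply (D.extH x)) y

/-- The Gram matrix of `h` with respect to the basis `e`. -/
def gram : Matrix (Fin 4) (Fin 4) F := Matrix.of fun i j => D.h (D.e i) (D.e j)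

/-- The scalar `δ = det H / N(b (e₁ ∧ e₂ ∧ e₃ ∧ e₄))`. -/
def δ : F := D.gram.det / (D.σ D.volume * D.volume)

theorem σ_δ : D.σ D.δ = D.δ := by
  have : D.σ D.gram.det = D.gram.det := by
    rw [RingHom.map_det, ← Matrix.det_transpose]
    congr 1
    ext i j
    exact (D.hermitian (D.e j) (D.e i)).symm
  rw [δ, map_div₀, this, map_mul, D.σ_σ, mul_comm]

instance σ_comp_σ : RingHomCompTriple D.σ D.σ (RingHom.id F) := ⟨RingHom.ext D.σ_σ⟩

theorem gram_mul_toMatrix (v : Fin 4 → V) :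
    D.gram * D.e.toMatrix v = Matrix.of fun i j => D.h (D.e i) (v j) := by
  ext i j
  have := congrArg (D.h (D.e i)) (D.e.sum_repr (v j))
  simp only [map_sum, map_smul, smul_eq_mul] at this
  rw [Matrix.of_apply, ← this]
  simp [Matrix.mul_apply, gram, Basis.toMatrix_apply, mul_comm]

theorem extH_J (x y : ⋀[F]^2 V) : D.extH (D.J x) y = D.δ * D.pf x y := by
  have key : (D.extH.comp D.J : ⋀[F]^2 V →ₗ[F] ⋀[F]^2 V →ₗ[F] F) = D.δ • D.pf := by
    apply exteriorPower.linearMap_ext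
    ext v : 1
    apply exteriorPower.linearMap_ext
    ext w
    obtain ⟨x, y, rfl⟩ : ∃ x y, v = ![x, y] := ⟨v 0, v 1, by ext k; fin_cases k <;> rfl⟩
    obtain ⟨z, t, rfl⟩ : ∃ z t, w = ![z, t] := ⟨w 0, w 1, by ext k; fin_cases k <;> rfl⟩
    have hdet : D.gram.det * D.e.det ![x, y, z, t] =
        (Matrix.of fun i j => D.h (D.e i) (![x, y, z, t] j)).det := by
      rw [← gram_mul_toMatrix, Matrix.det_mul, Basis.det_apply]
    have hv := D.volume_ne_zero
    have hv' : D.σ D.volume ≠ 0 := by simpa using hv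
    have hJ := congrArg (fun q => D.extH q (exteriorPower.ιMulti F 2 ![z, t]))
      (D.volume_smul (D.J (exteriorPower.ιMulti F 2 ![x, y])))
    simp only [pf_J, bivector, extH_ιMulti, map_add, map_sub, map_smulₛₗ, LinearMap.add_apply,
      LinearMap.sub_apply, LinearMap.smul_apply, smul_eq_mul, map_mul, ← D.hermitian] at hJ
    simp only [LinearMap.compAlternatingMap_apply, LinearMap.comp_apply, LinearMap.smul_apply,
      pf_ιMulti, smul_eq_mul, δ]
    have : D.σ D.volume * D.extH (D.J (exteriorPower.ιMulti F 2 ![x, y]))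
        (exteriorPower.ιMulti F 2 ![z, t]) = D.gram.det * D.e.det ![x, y, z, t] := by
      rw [hJ, hdet]
      simp [Matrix.det_succ_row_zero, Fin.sum_univ_succ, Fin.succAbove]
      ring1
    field_simp
    linear_combination this
  exact LinearMap.congr_fun (LinearMap.congr_fun key x) y

theorem J_J (x : ⋀[F]^2 V) : D.J (D.J x) = D.δ • x := by
  apply D.pf_injective
  refine LinearMap.ext fun y => ?_
  rw [pf_J, extH_J]
  simp

/-- The matrix of `x₀ + j x₁`. -/
def mat (x₀ x₁ : F) : Matrix (Fin 2) (Fin 2) F := !![x₀, D.δ * D.σ x₁; x₁, D.σ x₀]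

/-- The algebra `K` of all matrices `!![x₀, δ σ(x₁); x₁, σ(x₀)]`. -/
def K : Subring (Matrix (Fin 2) (Fin 2) F) where
  carrier := {M | ∃ x₀ x₁, M = D.mat x₀ x₁}
  zero_mem' := ⟨0, 0, by ext i j; fin_cases i <;> fin_cases j <;> simp [mat]⟩
  one_mem' := ⟨1, 0, by ext i j; fin_cases i <;> fin_cases j <;> simp [mat]⟩
  add_mem' := by
    rintro _ _ ⟨x₀, x₁, rfl⟩ ⟨y₀, y₁, rfl⟩
    exact ⟨x₀ + y₀, x₁ + y₁, by
      ext i j; fin_cases i <;> fin_cases j <;> simp [mat, mul_add]⟩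
  neg_mem' := by
    rintro _ ⟨x₀, x₁, rfl⟩
    exact ⟨-x₀, -x₁, by ext i j; fin_cases i <;> fin_cases j <;> simp [mat]⟩
  mul_mem' := by
    rintro _ _ ⟨x₀, x₁, rfl⟩ ⟨y₀, y₁, rfl⟩
    refine ⟨x₀ * y₀ + D.δ * D.σ x₁ * y₁, x₁ * y₀ + D.σ x₀ * y₁, ?_⟩
    ext i j
    fin_cases i <;> fin_cases j <;> simp [mat, Matrix.mul_apply, D.σ_σ, D.σ_δ] <;> ring

/-- `F` inside `K`, as the matrices `!![s, 0; 0, σ(s)]`. -/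
def ofF (s : F) : D.K := ⟨D.mat s 0, s, 0, rfl⟩

/-- The element `j = !![0, δ; 1, 0]` of `K`. -/
def j : D.K := ⟨D.mat 0 1, 0, 1, rfl⟩

/-- `K` is split if it contains divisors of zero. -/
def IsSplit : Prop := ∃ x y : D.K, x ≠ 0 ∧ y ≠ 0 ∧ x * y = 0

/-- The involution `α(x₀ + j x₁) = σ(x₀) + j x₁` of `K`. -/
def α (k : D.K) : D.K := D.ofF (D.σ (k.1 0 0)) + D.j * D.ofF (k.1 1 0)

theorem apply_zero_one (k : D.K) : k.1 0 1 = D.δ * D.σ (k.1 1 0) := by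
  obtain ⟨_, x₀, x₁, rfl⟩ := k
  simp [mat]

theorem apply_one_one (k : D.K) : k.1 1 1 = D.σ (k.1 0 0) := by
  obtain ⟨_, x₀, x₁, rfl⟩ := k
  simp [mat]

/-- `⋀² V` as a right `K`-module: `x (x₀ + j x₁) = x x₀ + J(x) x₁`. -/
instance : Module D.Kᵐᵒᵖ (⋀[F]^2 V) where
  smul k x := k.unop.1 0 0 • x + k.unop.1 1 0 • D.J x
  one_smul x := by
    change (1 : Matrix (Fin 2) (Fin 2) F) 0 0 • x + (1 : Matrix (Fin 2) (Fin 2) F) 1 0 • D.J x = x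
    simp
  mul_smul k l x := by
    change (l.unop.1 * k.unop.1) 0 0 • x + (l.unop.1 * k.unop.1) 1 0 • D.J x =
      k.unop.1 0 0 • (l.unop.1 0 0 • x + l.unop.1 1 0 • D.J x) +
        k.unop.1 1 0 • D.J (l.unop.1 0 0 • x + l.unop.1 1 0 • D.J x)
    simp only [Matrix.mul_apply, Fin.sum_univ_two, D.apply_zero_one, D.apply_one_one, map_add,
      map_smulₛₗ, D.J_J]
    module
  smul_zero k := by
    change k.unop.1 0 0 • (0 : ⋀[F]^2 V) + k.unop.1 1 0 • D.J 0 = 0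
    simp
  smul_add k x y := by
    change k.unop.1 0 0 • (x + y) + k.unop.1 1 0 • D.J (x + y) =
      (k.unop.1 0 0 • x + k.unop.1 1 0 • D.J x) + (k.unop.1 0 0 • y + k.unop.1 1 0 • D.J y)
    rw [map_add]
    module
  add_smul k l x := by
    change (k.unop.1 0 0 + l.unop.1 0 0) • x + (k.unop.1 1 0 + l.unop.1 1 0) • D.J x =
      (k.unop.1 0 0 • x + k.unop.1 1 0 • D.J x) + (l.unop.1 0 0 • x + l.unop.1 1 0 • D.J x)
    module
  zero_smul x := by
    change (0 : F) • x + (0 : F) • D.J x = 0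
    simp

theorem smul_def (k : D.K) (x : ⋀[F]^2 V) :
    MulOpposite.op k • x = k.1 0 0 • x + k.1 1 0 • D.J x := rfl

/-- The `α`-hermitian form `g(x, y) = ⋀²h(x, y) + j Pf(x, y)` on the right `K`-module `⋀² V`. -/
def g (x y : ⋀[F]^2 V) : D.K := D.ofF (D.extH x y) + D.j * D.ofF (D.pf x y)

/-- The special unitary group `SU(V, h)`. -/
def SU : Subgroup (V ≃ₗ[F] V) where
  carrier := {γ | LinearMap.det (γ : V →ₗ[F] V) = 1 ∧ ∀ x y, D.h (γ x) (γ y) = D.h x y}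
  one_mem' := ⟨LinearMap.det_id, fun _ _ => rfl⟩
  mul_mem' := by
    rintro γ τ ⟨h₁, h₂⟩ ⟨h₃, h₄⟩
    refine ⟨?_, fun x y => ?_⟩
    · change LinearMap.det ((γ : V →ₗ[F] V) ∘ₗ (τ : V →ₗ[F] V)) = 1
      rw [LinearMap.det_comp, h₁, h₃, one_mul]
    · change D.h (γ (τ x)) (γ (τ y)) = D.h x y
      rw [h₂, h₄]
  inv_mem' := by
    rintro γ ⟨h₁, h₂⟩
    refine ⟨?_, fun x y => ?_⟩
    · have := LinearEquiv.det_symm_mul_det γ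
      rwa [h₁, mul_one] at this
    · change D.h (γ.symm x) (γ.symm y) = D.h x y
      rw [← h₂, γ.apply_symm_apply, γ.apply_symm_apply]

/-- The unitary group `U(⋀² V, g)` of all `K`-linear isometries. -/
def U : Subgroup (⋀[F]^2 V ≃ₗ[D.Kᵐᵒᵖ] ⋀[F]^2 V) where
  carrier := {T | ∀ x y, D.g (T x) (T y) = D.g x y}
  one_mem' := fun _ _ => rfl
  mul_mem' := by
    intro S T hS hT x y
    change D.g (S (T x)) (S (T y)) = D.g x y
    rw [hS, hT]
  inv_mem' := by
    intro T hT x y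
    change D.g (T.symm x) (T.symm y) = D.g x y
    rw [← hT, T.apply_symm_apply, T.apply_symm_apply]

theorem extH_map {γ : V ≃ₗ[F] V} (hγ : γ ∈ D.SU) (x y : ⋀[F]^2 V) :
    D.extH (exteriorPower.map 2 (γ : V →ₗ[F] V) x) (exteriorPower.map 2 (γ : V →ₗ[F] V) y) =
      D.extH x y := by
  have key : ((LinearMap.lcomp F F (exteriorPower.map 2 (γ : V →ₗ[F] V))).comp D.extH).comp
      (exteriorPower.map 2 (γ : V →ₗ[F] V)) = D.extH := by
    apply LinearMap.ext_on (exteriorPower.ιMulti_span F 2 V)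
    rintro _ ⟨v, rfl⟩
    apply exteriorPower.linearMap_ext
    ext w
    obtain ⟨x, y, rfl⟩ : ∃ x y, v = ![x, y] := ⟨v 0, v 1, by ext k; fin_cases k <;> rfl⟩
    obtain ⟨z, t, rfl⟩ : ∃ z t, w = ![z, t] := ⟨w 0, w 1, by ext k; fin_cases k <;> rfl⟩
    have hm : ∀ a b : V, exteriorPower.map 2 (γ : V →ₗ[F] V) (exteriorPower.ιMulti F 2 ![a, b]) =
        exteriorPower.ιMulti F 2 ![γ a, γ b] := by
      intro a b
      rw [exteriorPower.map_apply_ιMulti]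
      congr 1
      ext k; fin_cases k <;> rfl
    change D.extH (exteriorPower.map 2 (γ : V →ₗ[F] V) (exteriorPower.ιMulti F 2 ![x, y]))
      (exteriorPower.map 2 (γ : V →ₗ[F] V) (exteriorPower.ιMulti F 2 ![z, t])) = _
    rw [hm, hm, extH_ιMulti, LinearMap.compAlternatingMap_apply, extH_ιMulti]
    simp only [hγ.2]
  exact LinearMap.congr_fun (LinearMap.congr_fun key x) y

theorem pf_map {γ : V ≃ₗ[F] V} (hγ : γ ∈ D.SU) (x y : ⋀[F]^2 V) :
    D.pf (exteriorPower.map 2 (γ : V →ₗ[F] V) x) (exteriorPower.map 2 (γ : V →ₗ[F] V) y) =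
      D.pf x y := by
  have key : D.pf.compl₁₂ (exteriorPower.map 2 (γ : V →ₗ[F] V))
      (exteriorPower.map 2 (γ : V →ₗ[F] V)) = D.pf := by
    apply exteriorPower.linearMap_ext
    ext v : 1
    apply exteriorPower.linearMap_ext
    ext w
    obtain ⟨x, y, rfl⟩ : ∃ x y, v = ![x, y] := ⟨v 0, v 1, by ext k; fin_cases k <;> rfl⟩
    obtain ⟨z, t, rfl⟩ : ∃ z t, w = ![z, t] := ⟨w 0, w 1, by ext k; fin_cases k <;> rfl⟩
    have hm : ∀ a b : V, exteriorPower.map 2 (γ : V →ₗ[F] V) (exteriorPower.ιMulti F 2 ![a, b]) =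
        exteriorPower.ιMulti F 2 ![γ a, γ b] := by
      intro a b
      rw [exteriorPower.map_apply_ιMulti]
      congr 1
      ext k; fin_cases k <;> rfl
    change D.pf (exteriorPower.map 2 (γ : V →ₗ[F] V) (exteriorPower.ιMulti F 2 ![x, y]))
      (exteriorPower.map 2 (γ : V →ₗ[F] V) (exteriorPower.ιMulti F 2 ![z, t])) =
        D.pf (exteriorPower.ιMulti F 2 ![x, y]) (exteriorPower.ιMulti F 2 ![z, t])
    have hc : ![γ x, γ y, γ z, γ t] = (γ : V →ₗ[F] V) ∘ ![x, y, z, t] := by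
      ext k; fin_cases k <;> rfl
    rw [hm, hm, pf_ιMulti, pf_ιMulti, hc, Basis.det_comp, hγ.1, one_mul]
  exact LinearMap.congr_fun (LinearMap.congr_fun key x) y

theorem J_map {γ : V ≃ₗ[F] V} (hγ : γ ∈ D.SU) (x : ⋀[F]^2 V) :
    D.J (exteriorPower.map 2 (γ : V →ₗ[F] V) x) = exteriorPower.map 2 (γ : V →ₗ[F] V) (D.J x) := by
  apply D.pf_injective
  refine LinearMap.ext fun z => ?_
  obtain ⟨y, rfl⟩ := exteriorPower.map_surjective (n := 2) (f := (γ : V →ₗ[F] V)) γ.surjective z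
  rw [D.pf_map hγ, pf_J, pf_J, D.extH_map hγ]

theorem map_map_symm (γ : V ≃ₗ[F] V) (x : ⋀[F]^2 V) :
    exteriorPower.map 2 (γ : V →ₗ[F] V) (exteriorPower.map 2 (γ.symm : V →ₗ[F] V) x) = x := by
  rw [← LinearMap.comp_apply, ← exteriorPower.map_comp]
  simp

/-- The `K`-linear automorphism `⋀² γ` of `⋀² V`, for `γ ∈ SU(V, h)`. -/
def extEquiv (γ : D.SU) : ⋀[F]^2 V ≃ₗ[D.Kᵐᵒᵖ] ⋀[F]^2 V where
  toFun := exteriorPower.map 2 (γ.1 : V →ₗ[F] V)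
  invFun := exteriorPower.map 2 (γ.1.symm : V →ₗ[F] V)
  map_add' := map_add _
  map_smul' k x := by
    change exteriorPower.map 2 (γ.1 : V →ₗ[F] V) (k.unop.1 0 0 • x + k.unop.1 1 0 • D.J x) =
      k.unop.1 0 0 • exteriorPower.map 2 (γ.1 : V →ₗ[F] V) x +
        k.unop.1 1 0 • D.J (exteriorPower.map 2 (γ.1 : V →ₗ[F] V) x)
    rw [D.J_map γ.2, map_add, map_smul, map_smul]
  left_inv x := map_map_symm γ.1.symm x
  right_inv x := map_map_symm γ.1 x

/-- The homomorphism `η : SU(V, h) → U(⋀² V, g)`, `γ ↦ ⋀² γ`. -/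
def η : D.SU →* D.U where
  toFun γ := ⟨D.extEquiv γ, fun x y => by
    change D.g (exteriorPower.map 2 (γ.1 : V →ₗ[F] V) x)
      (exteriorPower.map 2 (γ.1 : V →ₗ[F] V) y) = D.g x y
    rw [g, g, D.extH_map γ.2, D.pf_map γ.2]⟩
  map_one' := by
    apply Subtype.ext
    ext1 x
    change exteriorPower.map 2 (LinearMap.id : V →ₗ[F] V) x = x
    simp
  map_mul' γ τ := by
    apply Subtype.ext
    ext1 x
    change exteriorPower.map 2 ((γ.1 : V →ₗ[F] V) ∘ₗ (τ.1 : V →ₗ[F] V)) x =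
      exteriorPower.map 2 (γ.1 : V →ₗ[F] V) (exteriorPower.map 2 (τ.1 : V →ₗ[F] V) x)
    rw [exteriorPower.map_comp]
    rfl

/-- `T` is the Eichler transformation `Σ_{z,w,p}` of `(⋀² V, g)`, i.e.
`x ↦ x + z g(w, x) - (w + z p) g(z, x)` with `g(z, z) = 0 = g(z, w)` and `α(p) + p = g(w, w)`.
Scalars of `K` act from the right. -/
def IsEichlerWith (T : D.U) (z w : ⋀[F]^2 V) (p : D.K) : Prop :=
  D.g z z = 0 ∧ D.g z w = 0 ∧ D.α p + p = D.g w w ∧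
    ∀ x, T.1 x = x + MulOpposite.op (D.g w x) • z -
      MulOpposite.op (D.g z x) • (w + MulOpposite.op p • z)

/-- Eichler transformations of `(⋀² V, g)`. -/
def IsEichler (T : D.U) : Prop := ∃ z w p, D.IsEichlerWith T z w p

/-- Isotropic transvections of `(⋀² V, g)`: the Eichler transformations `Σ_{z,0,p}`. -/
def IsIsotropicTransvection (T : D.U) : Prop := ∃ z p, D.IsEichlerWith T z 0 p

/-- The group `EU(⋀² V, g)` generated by all Eichler transformations. -/
def EU : Subgroup D.U := Subgroup.closure {T | D.IsEichler T}

/-- The form `h` is isotropic. -/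
def IsIsotropic : Prop := ∃ x : V, x ≠ 0 ∧ D.h x x = 0

end HermitianFourSpace

end

/-! The equality comes from the circle of inclusions `D.η.range` ≤ ⟨isotropic transvections⟩ ≤
`D.EU` ≤ `D.η.range`, whose middle link is trivial.

The link from the range to isotropic transvections rests on the generation of SU(V,h) by unitary
transvections (`transvectionGroup_top_eq_SU`). Since `K` is not split, δ is not a norm and h has
Witt index at most 1 (`exists_smul_eq_of_isotropic`). Products of transvections contain Weyl
elements exchanging two non-orthogonal isotropic lines, a torus acting by every nonzero scalar on an
isotropic vector, and enough elements fixing a to carry any isotropic c with h(a,c) = 1 to any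
other. This reduces a given γ to one that fixes a hyperbolic pair, and on the remaining anisotropic
plane γ is a quotient of two torus elements. The exterior square of a transvection along a is an
isotropic transvection of g with z = a∧v, for any anisotropic v orthogonal to a that belongs to a
frame (`Frame.isEichlerWith_transvection`).

The link from `D.EU` to the range rests on the shape of the isotropic vectors of g: Pf(z,z) = 0
makes z decomposable, and ⋀²h(z,z) = 0 makes its plane degenerate, so z = a∧v with a isotropic and
orthogonal to v. Any Σ_{z,w,p} with such a nonzero z is then the exterior square of an explicit
Eichler transformation of (V,h) along a (`Frame.mem_range_of_isEichlerWith`). -/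

noncomputable section

/-! ### Unitary transvections, Weyl elements and torus elements of (V,h) -/

namespace HermitianFourSpace

variable {F : Type u} {V : Type v} [Field F] [AddCommGroup V] [Module F V]
  (D : HermitianFourSpace F V)

/-- The unitary transvection `x ↦ x + u s h(u, x)` along an isotropic vector `u`. -/
def unitaryTransvection {u : V} (hu : D.h u u = 0) (s : F) : V ≃ₗ[F] V :=
  LinearEquiv.transvection (f := s • D.h u) (v := u) (by simp [hu])

theorem unitaryTransvection_apply {u : V} (hu : D.h u u = 0) (s : F) (x : V) :
    D.unitaryTransvection hu s x = x + (s * D.h u x) • u := by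
  simp [unitaryTransvection, LinearMap.transvection.apply]

theorem h_symm_zero {x y : V} (hxy : D.h x y = 0) : D.h y x = 0 := by
  rw [D.hermitian, hxy, map_zero]

theorem h_symm_one {x y : V} (hxy : D.h x y = 1) : D.h y x = 1 := by
  rw [D.hermitian, hxy, map_one]

theorem unitaryTransvection_mem_SU {u : V} (hu : D.h u u = 0) {s : F} (hs : D.σ s = -s) :
    D.unitaryTransvection hu s ∈ D.SU := by
  have : Module.Finite F V := Module.Finite.of_basis D.e
  refine ⟨?_, fun x y => ?_⟩
  · have := LinearEquiv.transvection.det_eq_one (f := s • D.h u) (v := u) (by simp [hu])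
    rw [← LinearEquiv.coe_det, unitaryTransvection, this]
    rfl
  · simp only [unitaryTransvection_apply, map_add, map_smulₛₗ, LinearMap.add_apply,
      LinearMap.smul_apply, smul_eq_mul, map_mul, hs, hu, RingHom.id_apply, D.hermitian u x]
    ring

/-- The group generated by the unitary transvections along isotropic vectors of a subspace. -/
def transvectionGroup (X : Submodule F V) : Subgroup (V ≃ₗ[F] V) :=
  Subgroup.closure {τ | ∃ u ∈ X, ∃ hu : D.h u u = 0, ∃ s, D.σ s = -s ∧
    τ = D.unitaryTransvection hu s}

variable {D} {X : Submodule F V}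

theorem unitaryTransvection_mem {u : V} (huX : u ∈ X) (hu : D.h u u = 0) {s : F}
    (hs : D.σ s = -s) : D.unitaryTransvection hu s ∈ D.transvectionGroup X :=
  Subgroup.subset_closure ⟨u, huX, hu, s, hs, rfl⟩

theorem transvectionGroup_le_SU : D.transvectionGroup X ≤ D.SU := by
  rw [transvectionGroup, Subgroup.closure_le]
  rintro _ ⟨u, -, hu, s, hs, rfl⟩
  exact D.unitaryTransvection_mem_SU hu hs

theorem transvectionGroup_mono {Y : Submodule F V} (hXY : X ≤ Y) :
    D.transvectionGroup X ≤ D.transvectionGroup Y := by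
  apply Subgroup.closure_mono
  rintro _ ⟨u, huX, h⟩
  exact ⟨u, hXY huX, h⟩

theorem transvectionGroup_apply_mem {t : V ≃ₗ[F] V} (ht : t ∈ D.transvectionGroup X) :
    ∀ x ∈ X, t x ∈ X := by
  let S : Submonoid (V ≃ₗ[F] V) :=
    { carrier := {t | ∀ x ∈ X, t x ∈ X}
      one_mem' := fun x hx => hx
      mul_mem' := fun {s t} hs ht x hx => hs _ (ht x hx) }
  -- The condition t(X) ⊆ X is not visibly stable under inversion, so t and its inverse are carried
  -- through the induction together.
  have key : ∀ t ∈ D.transvectionGroup X, t ∈ S ∧ t⁻¹ ∈ S := by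
    intro t ht
    induction ht using Subgroup.closure_induction with
    | mem t h =>
      obtain ⟨u, huX, hu, s, hs, rfl⟩ := h
      refine ⟨fun x hx => ?_, fun x hx => ?_⟩
      · rw [unitaryTransvection_apply]
        exact X.add_mem hx (X.smul_mem _ huX)
      · have : (D.unitaryTransvection hu s)⁻¹ x = x - (s * D.h u x) • u := by
          rw [LinearEquiv.coe_inv, LinearEquiv.symm_apply_eq, unitaryTransvection_apply]
          simp [hu]
        rw [this]
        exact X.sub_mem hx (X.smul_mem _ huX)
    | one => exact ⟨S.one_mem, by simp⟩
    | mul s t _ _ hs ht => exact ⟨S.mul_mem hs.1 ht.1, by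
        rw [mul_inv_rev]; exact S.mul_mem ht.2 hs.2⟩
    | inv t _ ht => exact ⟨ht.2, by simpa using ht.1⟩
  exact (key t ht).1

/-- This is the reason for recording the subspace X: a product built inside w^⊥ automatically fixes
w. -/
theorem transvectionGroup_apply_eq_self {t : V ≃ₗ[F] V} (ht : t ∈ D.transvectionGroup X) {y : V}
    (hy : ∀ x ∈ X, D.h x y = 0) : t y = y := by
  induction ht using Subgroup.closure_induction with
  | mem t h =>
    obtain ⟨u, huX, hu, s, hs, rfl⟩ := h
    rw [unitaryTransvection_apply, hy u huX]
    simp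
  | one => rfl
  | mul s t _ _ hs ht => rw [LinearEquiv.mul_apply, ht, hs]
  | inv t _ ht =>
    rw [LinearEquiv.coe_inv, LinearEquiv.symm_apply_eq, ht]

/-- The SL₂ identity for a Weyl element: the transvections along a, b, a with parameters s, -s⁻¹, s
multiply to a ↦ -s⁻¹b, b ↦ sa, the identity on the complement of the hyperbolic plane. -/
theorem exists_weyl {a b : V} (ha : a ∈ X) (hb : b ∈ X) (haa : D.h a a = 0) (hbb : D.h b b = 0)
    (hab : D.h a b = 1) {s : F} (hs : D.σ s = -s) (hs0 : s ≠ 0) :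
    ∃ t ∈ D.transvectionGroup X, ∀ x,
      t x = x - D.h b x • a - D.h a x • b - (s⁻¹ * D.h b x) • b + (s * D.h a x) • a := by
  have hs' : D.σ (-s⁻¹) = -(-s⁻¹) := by rw [map_neg, map_inv₀, hs, inv_neg]
  refine ⟨D.unitaryTransvection haa s * D.unitaryTransvection hbb (-s⁻¹) *
    D.unitaryTransvection haa s, mul_mem (mul_mem (unitaryTransvection_mem ha haa hs)
    (unitaryTransvection_mem hb hbb hs')) (unitaryTransvection_mem ha haa hs), fun x => ?_⟩
  simp only [LinearEquiv.mul_apply, unitaryTransvection_apply, map_add, map_smul,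
    haa, hab, D.h_symm_one hab]
  match_scalars <;> field_simp <;> ring

theorem exists_weyl_smul {a c : V} (ha : a ∈ X) (hc : c ∈ X) (haa : D.h a a = 0)
    (hcc : D.h c c = 0) (hac : D.h a c ≠ 0) {s : F} (hs : D.σ s = -s) (hs0 : s ≠ 0) :
    ∃ t ∈ D.transvectionGroup X, t a = (-(s * D.h a c)⁻¹) • c := by
  have h1 : D.h a ((D.h a c)⁻¹ • c) = 1 := by simp [hac]
  obtain ⟨t, ht, h⟩ := exists_weyl ha (X.smul_mem (D.h a c)⁻¹ hc) haa (by simp [hcc]) h1 hs hs0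
  refine ⟨t, ht, ?_⟩
  rw [h, haa, D.h_symm_one h1]
  match_scalars <;> field_simp <;> simp

/-- Every σ(x) - x is skew, and they cannot all vanish. -/
theorem exists_skew (hσ : D.σ ≠ RingHom.id F) : ∃ s, D.σ s = -s ∧ s ≠ 0 := by
  by_contra! h
  refine hσ (RingHom.ext fun x => ?_)
  exact (sub_eq_zero.1 (h (D.σ x - x) (by simp [D.σ_σ])))

/-- The square of a Weyl element is -1 on the hyperbolic plane and 1 on its complement. -/
theorem exists_neg_on_plane (hσ : D.σ ≠ RingHom.id F) {a b : V} (ha : a ∈ X) (hb : b ∈ X)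
    (haa : D.h a a = 0) (hbb : D.h b b = 0) (hab : D.h a b = 1) :
    ∃ t ∈ D.transvectionGroup X, ∀ x, t x = x - (2 * D.h b x) • a - (2 * D.h a x) • b := by
  obtain ⟨s, hs, hs0⟩ := exists_skew hσ
  obtain ⟨t, ht, h⟩ := exists_weyl ha hb haa hbb hab hs hs0
  refine ⟨t * t, mul_mem ht ht, fun x => ?_⟩
  simp only [LinearEquiv.mul_apply, h, map_add, map_sub, map_smul, smul_eq_mul,
    haa, hbb, hab, D.h_symm_one hab]
  match_scalars <;> field_simp <;> ring

variable [NeZero (2 : F)]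

/-- The stabilizer of an isotropic vector `a` in the transvection group is transitive on the
isotropic vectors `c` with `h(a, c) = 1`. -/
theorem exists_map_opposite (hσ : D.σ ≠ RingHom.id F) {a b c : V} (ha : a ∈ X) (hb : b ∈ X)
    (hc : c ∈ X) (haa : D.h a a = 0) (hbb : D.h b b = 0) (hcc : D.h c c = 0)
    (hab : D.h a b = 1) (hac : D.h a c = 1) :
    ∃ t ∈ D.transvectionGroup X, t a = a ∧ t c = b := by
  have h2 : (2 : F) ≠ 0 := NeZero.ne 2
  have hba := D.h_symm_one hab
  have hca := D.h_symm_one hac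
  set q := D.h b c with hq
  have hcb : D.h c b = D.σ q := D.hermitian b c
  -- The transvection along a with this parameter replaces c by c + sa and removes the skew part of
  -- h(b,c), leaving the σ-fixed value r.
  set s : F := -(q - D.σ q) / 2 with hs
  have hsσ : D.σ s = -s := by
    rw [hs, map_div₀, map_neg, map_sub, D.σ_σ, map_ofNat]
    ring
  set r : F := (q + D.σ q) / 2 with hr
  have hrσ : D.σ r = r := by
    rw [hr, map_div₀, map_add, D.σ_σ, map_ofNat, add_comm]
  have hrq : q + s = r := by rw [hr, hs]; field_simp; ring
  -- The midpoint of b and c + sa, corrected along a to be isotropic. The difference c + sa - b is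
  -- orthogonal to a and m, so -1 on the plane of a, m sends c + sa to -b and a to -a. The
  -- involution for the plane of a, b then undoes both signs.
  set m : V := (2⁻¹ : F) • b + (2⁻¹ : F) • (c + s • a) + (-r / (2 * 2)) • a with hm
  have hmX : m ∈ X := X.add_mem (X.add_mem (X.smul_mem _ hb)
    (X.smul_mem _ (X.add_mem hc (X.smul_mem _ ha)))) (X.smul_mem _ ha)
  have hq'' : q = r - s := by rw [← hrq]; ring
  have ham : D.h a m = 1 := by
    simp only [hm, map_add, map_smul, smul_eq_mul, haa, hab, hac]
    field_simp; ring
  have hmc : D.h m (c + s • a) = r / (2 * 2) := by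
    simp only [hm, map_add, map_smulₛₗ, LinearMap.add_apply, LinearMap.smul_apply, smul_eq_mul,
      haa, hac, hca, hba, hcc, ← hq, hq'', map_inv₀, map_ofNat, map_neg, map_div₀, hrσ, hsσ,
      RingHom.id_apply, map_mul]
    field_simp; ring
  have hmm : D.h m m = 0 := by
    simp only [hm, map_add, map_smulₛₗ, LinearMap.add_apply, LinearMap.smul_apply, smul_eq_mul,
      haa, hab, hac, hca, hba, hcc, hbb, hcb, ← hq, hq'', map_inv₀, map_ofNat, map_neg,
      map_div₀, hrσ, hsσ, RingHom.id_apply, map_mul, map_sub]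
    field_simp; ring
  obtain ⟨d, hd, hd'⟩ := exists_neg_on_plane hσ ha hmX haa hmm ham
  obtain ⟨d₂, hd₂, hd₂'⟩ := exists_neg_on_plane hσ ha hb haa hbb hab
  refine ⟨d₂ * (d * D.unitaryTransvection haa s),
    mul_mem hd₂ (mul_mem hd (unitaryTransvection_mem ha haa hsσ)), ?_, ?_⟩
  · simp only [LinearEquiv.mul_apply, unitaryTransvection_apply, hd', hd₂', haa, hba,
      D.h_symm_one ham, map_sub, map_smul, map_add, smul_eq_mul]
    match_scalars <;> ring
  · have h1 : d (c + s • a) = -b := by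
      rw [hd', hmc]
      simp only [map_add, map_smul, haa, hac, hm, smul_eq_mul]
      match_scalars <;> field_simp <;> ring
    rw [LinearEquiv.mul_apply, LinearEquiv.mul_apply, unitaryTransvection_apply, hac, mul_one, h1,
      hd₂']
    simp only [map_neg, hbb, hab]
    match_scalars <;> ring

/-- The torus elements of the three-dimensional space spanned by a hyperbolic pair `a, b` and an
orthogonal anisotropic vector `v` are products of transvections. -/
theorem exists_torus (hσ : D.σ ≠ RingHom.id F) {a b v : V} (ha : a ∈ X) (hb : b ∈ X)
    (hv : v ∈ X) (haa : D.h a a = 0) (hbb : D.h b b = 0) (hab : D.h a b = 1) (hav : D.h a v = 0)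
    (hbv : D.h b v = 0) (hvv : D.h v v ≠ 0) {l : F} (hl : l ≠ 0) :
    ∃ t ∈ D.transvectionGroup X, t a = l • a ∧ t b = (D.σ l)⁻¹ • b := by
  obtain ⟨s, hs, hs0⟩ := exists_skew hσ
  have hba := D.h_symm_one hab
  have hσl : D.σ l ≠ 0 := by simpa using hl
  by_cases hlσ : D.σ l = l
  -- For σ-fixed l the parameter -sl is again skew, and two Weyl elements suffice: a ↦ -s⁻¹b ↦ la.
  · obtain ⟨t₁, ht₁, h₁⟩ := exists_weyl ha hb haa hbb hab hs hs0
    obtain ⟨t₂, ht₂, h₂⟩ := exists_weyl ha hb haa hbb hab (s := -s * l)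
      (by simp [hs, hlσ]) (by simp [hs0, hl])
    refine ⟨t₂ * t₁, mul_mem ht₂ ht₁, ?_, ?_⟩ <;>
    · simp only [LinearEquiv.mul_apply, h₁, h₂, map_sub, map_add, map_smul, smul_eq_mul, haa, hbb,
        hab, hba, hlσ]
      match_scalars <;> field_simp <;> ring
  -- For other l the path goes a → c → b → a through a third isotropic vector c = b + v + qa. The
  -- total scalar is sf/σ(q), hence σ(q) = fs/l. The σ-fixed factor f is chosen so that q + σ(q) =
  -- -h(v,v), which makes c isotropic; this needs the trace of s/l to be nonzero, that is, σ(l) ≠ l.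
  · have htr : s / l + D.σ (s / l) ≠ 0 := by
      rw [map_div₀, hs]
      intro h0
      field_simp at h0
      apply hlσ
      have := mul_left_cancel₀ hs0 (h0.trans (by ring : _ = s * 0))
      linear_combination this
    set τ := s / l + D.σ (s / l) with hτ
    have hτσ : D.σ τ = τ := by rw [hτ, map_add, D.σ_σ, add_comm]
    set f := -D.h v v / τ with hf
    have hf0 : f ≠ 0 := div_ne_zero (neg_ne_zero.2 hvv) htr
    have hfσ : D.σ f = f := by rw [hf, map_div₀, map_neg, hτσ, ← D.hermitian]
    set q := D.σ (f * (s / l)) with hq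
    have hqσ : D.σ q = f * (s / l) := D.σ_σ _
    have hq0 : D.σ q ≠ 0 := by rw [hqσ]; exact mul_ne_zero hf0 (div_ne_zero hs0 hl)
    have hqtr : q + D.σ q = -D.h v v := by
      rw [hqσ, hq, map_mul, hfσ, ← mul_add, add_comm, ← hτ, hf, div_mul_cancel₀ _ htr]
    set c := b + v + q • a with hc
    have hcX : c ∈ X := X.add_mem (X.add_mem hb hv) (X.smul_mem _ ha)
    have hac : D.h a c = 1 := by simp [hc, hab, hav, haa]
    have hcb : D.h c b = D.σ q := by simp [hc, hbb, D.h_symm_zero hbv, hab]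
    have hcc : D.h c c = 0 := by
      simp only [hc, map_add, map_smulₛₗ, LinearMap.add_apply, LinearMap.smul_apply, smul_eq_mul,
        haa, hab, hba, hbb, hav, hbv, D.h_symm_zero hav, D.h_symm_zero hbv, RingHom.id_apply]
      linear_combination hqtr
    obtain ⟨t₁, ht₁, h₁⟩ := exists_weyl_smul ha hcX haa hcc (by rw [hac]; exact one_ne_zero) hs hs0
    obtain ⟨t₂, ht₂, h₂⟩ := exists_weyl_smul hcX hb hcc hbb (by rwa [hcb]) hs hs0
    have hs3 : D.σ (-(s * s * (f * s))⁻¹) = -(-(s * s * (f * s))⁻¹) := by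
      rw [map_neg, map_inv₀, map_mul, map_mul, map_mul, hs, hfσ, neg_mul_neg, mul_neg, mul_neg,
        inv_neg]
    obtain ⟨t₃, ht₃, h₃⟩ := exists_weyl_smul hb ha hbb haa (by rw [hba]; exact one_ne_zero) hs3
      (by simp [hs0, hf0])
    have hTX : t₃ * (t₂ * t₁) ∈ D.transvectionGroup X := mul_mem ht₃ (mul_mem ht₂ ht₁)
    set t := t₃ * (t₂ * t₁) with ht
    have hta : t a = l • a := by
      rw [ht, LinearEquiv.mul_apply, LinearEquiv.mul_apply, h₁, map_smul, h₂, map_smul, map_smul,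
        h₃, hac, hcb, hba, hqσ]
      match_scalars
      field_simp
    have htSU := (transvectionGroup_le_SU hTX).2
    -- The product sends a to la, but b only to some isotropic vector with h(a, σ(l)·tb) = 1; an
    -- element fixing a moves σ(l)·tb to b.
    obtain ⟨n, hn, hna, hnb⟩ := exists_map_opposite hσ ha hb
      (X.smul_mem (D.σ l) (transvectionGroup_apply_mem hTX b hb)) haa hbb
      (by simp [htSU, hbb]) hab
      (by have := htSU a b
          rw [hta, hab] at this
          simpa using this)
    refine ⟨n * t, mul_mem hn hTX, ?_, ?_⟩
    · rw [LinearEquiv.mul_apply, hta, map_smul, hna]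
    · rw [LinearEquiv.mul_apply, ← one_smul F (t b), ← inv_mul_cancel₀ hσl, mul_smul, map_smul, hnb]

end HermitianFourSpace

/-! ### Witt index one, frames, and generation of SU(V,h) by transvections -/

namespace HermitianFourSpace

variable {F : Type u} {V : Type v} [Field F] [AddCommGroup V] [Module F V]
  (D : HermitianFourSpace F V)

/-- The same hermitian space with another basis. -/
def withBasis (e : Basis (Fin 4) F V) : HermitianFourSpace F V := { D with e := e }

/-- Pf depends on `b` alone, so the expansion `volume_smul` may be used in any adapted basis. -/
theorem pf_withBasis (e : Basis (Fin 4) F V) : (D.withBasis e).pf = D.pf := rfl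

theorem finrank_eq_four (D : HermitianFourSpace F V) : finrank F V = 4 := by
  rw [finrank_eq_card_basis D.e, Fintype.card_fin]

/-- Four linearly independent vectors as a basis. -/
def basisOfFour (D : HermitianFourSpace F V) {f : Fin 4 → V} (hf : LinearIndependent F f) :
    Basis (Fin 4) F V :=
  basisOfLinearIndependentOfCardEqFinrank hf (by rw [D.finrank_eq_four, Fintype.card_fin])

theorem coe_basisOfFour {f : Fin 4 → V} (hf : LinearIndependent F f) :
    ⇑(D.basisOfFour hf) = f :=
  coe_basisOfLinearIndependentOfCardEqFinrank _ _

theorem exists_h_eq_one {x : V} (hx : x ≠ 0) : ∃ y, D.h x y = 1 := by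
  by_contra! h
  refine hx (D.nondegenerate.1 x fun y => ?_)
  by_contra hy
  exact h ((D.h x y)⁻¹ • y) (by simp [hy])

/-- In `K` one has lj = jσ(l) and j² = δ, so (l - j)(σ(l) + j) = lσ(l) - δ = 0. -/
theorem isSplit_of_norm_eq {l : F} (hl : l * D.σ l = D.δ) : D.IsSplit := by
  have hl' : D.σ l * l = D.δ := by rw [mul_comm, hl]
  refine ⟨⟨D.mat l (-1), _, _, rfl⟩, ⟨D.mat (D.σ l) 1, _, _, rfl⟩, fun h => ?_, fun h => ?_, ?_⟩
  · have := congrFun (congrFun (congrArg Subtype.val h) 1) 0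
    simp [mat] at this
  · have := congrFun (congrFun (congrArg Subtype.val h) 1) 0
    simp [mat] at this
  · apply Subtype.ext
    ext i k
    fin_cases i <;> fin_cases k <;>
      simp [mat, D.σ_σ, hl, hl', mul_comm]

/-- If `K` is not split, then the Witt index of `h` is at most one. -/
theorem exists_smul_eq_of_isotropic (hsplit : ¬ D.IsSplit) {a c : V} (ha : a ≠ 0)
    (haa : D.h a a = 0) (hcc : D.h c c = 0) (hac : D.h a c = 0) : ∃ m : F, c = m • a := by
  obtain ⟨x, hax⟩ := D.exists_h_eq_one ha
  have hxa := D.h_symm_one hax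
  by_contra! hc
  have hd0 : c - D.h x c • a ≠ 0 := fun h => hc _ (sub_eq_zero.1 h)
  -- If c is not a multiple of a, then a, d span a totally isotropic plane; x, y are chosen dual to
  -- a, d.
  obtain ⟨d, hd⟩ : ∃ d, d = c - D.h x c • a := ⟨_, rfl⟩
  rw [← hd] at hd0
  have had : D.h a d = 0 := by simp [hd, haa, hac]
  have hdd : D.h d d = 0 := by simp [hd, haa, hac, hcc, D.h_symm_zero hac]
  have hxd : D.h x d = 0 := by simp [hd, hxa]
  have hdx := D.h_symm_zero hxd
  have hda := D.h_symm_zero had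
  obtain ⟨z, hdz⟩ := D.exists_h_eq_one hd0
  obtain ⟨y, hy⟩ : ∃ y, y = z - D.h a z • x := ⟨_, rfl⟩
  have hay : D.h a y = 0 := by simp [hy, hax]
  have hdy : D.h d y = 1 := by simp [hy, hdz, hdx]
  have hyd := D.h_symm_one hdy
  have hli : LinearIndependent F ![a, d, x, y] := by
    rw [Fintype.linearIndependent_iff]
    intro g hg
    simp only [Fin.sum_univ_four, Matrix.cons_val] at hg
    have e2 := congrArg (D.h a) hg
    have e3 := congrArg (D.h d) hg
    have e0 := congrArg (D.h x) hg
    have e1 := congrArg (D.h y) hg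
    simp only [map_add, map_smul, smul_eq_mul, map_zero, haa, had, hax, hay, hda, hdd, hdx, hdy,
      hxa, hxd, D.h_symm_zero hay, hyd, mul_zero, mul_one, zero_add, add_zero] at e0 e1 e2 e3
    rw [e2, e3] at e0 e1
    intro i
    fin_cases i
    · simpa using e0
    · simpa using e1
    · exact e2
    · exact e3
  have he := D.coe_basisOfFour hli
  let D' := D.withBasis (D.basisOfFour hli)
  have hvol : D'.volume ≠ 0 := D'.volume_ne_zero
  have hJ := D'.volume_smul (D.J (exteriorPower.ιMulti F 2 ![a, d]))
  have hb : ∀ i k, D'.bivector i k =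
      exteriorPower.ιMulti F 2 ![![a, d, x, y] i, ![a, d, x, y] k] := by
    intro i k
    rw [← he]; rfl
  simp only [D', pf_withBasis, D.pf_J] at hJ
  simp only [D'] at hb
  simp only [hb, extH_ιMulti, Matrix.cons_val, haa, had, hax, hay, hda, hdd, hdx, hdy] at hJ
  simp only [mul_zero, mul_one, sub_zero, zero_smul, one_smul, add_zero] at hJ
  set Z := exteriorPower.ιMulti F 2 ![a, d]
  set m := (D.withBasis (D.basisOfFour hli)).volume
  have hZ : Z ≠ 0 := by
    intro h0
    have h1 := (D'.pf_bivector a d).1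
    have ra : D'.e.repr a = Finsupp.single 0 1 := by
      rw [← D'.e.repr_self]; congr 1; exact (congrFun he 0).symm
    have rd : D'.e.repr d = Finsupp.single 1 1 := by
      rw [← D'.e.repr_self]; congr 1; exact (congrFun he 1).symm
    rw [show exteriorPower.ιMulti F 2 ![a, d] = 0 from h0, ra, rd] at h1
    simp at h1
    exact hvol h1.symm
  -- The Hodge operator fixes the line of a totally isotropic plane. As it is semilinear with square
  -- δ, the eigenvalue m⁻¹ has norm δ.
  have hJ' : D.J Z = m⁻¹ • Z := by
    rw [eq_inv_smul_iff₀ hvol, hJ]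
  have hJJ := D.J_J Z
  rw [hJ', map_smulₛₗ, hJ', smul_smul] at hJJ
  refine hsplit (D.isSplit_of_norm_eq (l := m⁻¹) ?_)
  rw [mul_comm]
  exact smul_left_injective F hZ hJJ

/-- A hyperbolic pair `a, b` and an orthogonal basis `v, w` of its orthogonal complement, both
anisotropic. -/
structure Frame (a b v w : V) : Prop where
  aa : D.h a a = 0
  bb : D.h b b = 0
  ab : D.h a b = 1
  av : D.h a v = 0
  aw : D.h a w = 0
  bv : D.h b v = 0
  bw : D.h b w = 0
  vw : D.h v w = 0
  vv : D.h v v ≠ 0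
  ww : D.h w w ≠ 0

variable {D}

namespace Frame

theorem swap {a b v w : V} (f : D.Frame a b v w) : D.Frame a b w v :=
  ⟨f.aa, f.bb, f.ab, f.aw, f.av, f.bw, f.bv, D.h_symm_zero f.vw, f.ww, f.vv⟩

theorem linearIndependent {a b v w : V} (f : D.Frame a b v w)
    : LinearIndependent F ![a, b, v, w] := by
  rw [Fintype.linearIndependent_iff]
  intro g hg
  simp only [Fin.sum_univ_four, Matrix.cons_val] at hg
  have e0 := congrArg (D.h b) hg
  have e1 := congrArg (D.h a) hg
  have e2 := congrArg (D.h v) hg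
  have e3 := congrArg (D.h w) hg
  simp only [map_add, map_smul, smul_eq_mul, map_zero, f.aa, f.bb, f.ab, D.h_symm_one f.ab, f.av,
    f.aw, f.bv, f.bw, f.vw, D.h_symm_zero f.av, D.h_symm_zero f.aw, D.h_symm_zero f.bv,
    D.h_symm_zero f.bw, D.h_symm_zero f.vw, mul_zero, mul_one, zero_add, add_zero,
    mul_eq_zero, f.vv, f.ww, or_false] at e0 e1 e2 e3
  intro i
  fin_cases i
  exacts [e0, e1, e2, e3]

end Frame

/-- The basis given by a frame. -/
def Frame.basis {a b v w : V} (f : D.Frame a b v w) : Basis (Fin 4) F V :=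
  D.basisOfFour f.linearIndependent

namespace Frame

theorem coe_basis {a b v w : V} (f : D.Frame a b v w)
    : ⇑f.basis = ![a, b, v, w] := D.coe_basisOfFour _

theorem eq_sum {a b v w : V} (f : D.Frame a b v w) (x : V) :
    x = D.h b x • a + D.h a x • b + (D.h v x / D.h v v) • v + (D.h w x / D.h w w) • w := by
  have hx := f.basis.sum_repr x
  simp only [coe_basis, Fin.sum_univ_four, Matrix.cons_val] at hx
  have e0 := congrArg (D.h b) hx
  have e1 := congrArg (D.h a) hx
  have e2 := congrArg (D.h v) hx
  have e3 := congrArg (D.h w) hx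
  simp only [map_add, map_smul, smul_eq_mul, f.aa, f.bb, f.ab, D.h_symm_one f.ab, f.av,
    f.aw, f.bv, f.bw, f.vw, D.h_symm_zero f.av, D.h_symm_zero f.aw, D.h_symm_zero f.bv,
    D.h_symm_zero f.bw, D.h_symm_zero f.vw, mul_zero, mul_one, zero_add, add_zero] at e0 e1 e2 e3
  rw [← e0, ← e1, ← e2, ← e3, mul_div_cancel_right₀ _ f.vv, mul_div_cancel_right₀ _ f.ww]
  exact hx.symm

theorem left_ne_zero {a b v w : V} (f : D.Frame a b v w) : a ≠ 0 := by
  rintro rfl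
  simpa using f.ab

theorem ext_equiv {a b v w : V} (f : D.Frame a b v w)
    {s t : V ≃ₗ[F] V} (ha : s a = t a) (hb : s b = t b) (hv : s v = t v)
    (hw : s w = t w) : s = t := by
  ext x
  rw [f.eq_sum x]
  simp only [map_add, map_smul, ha, hb, hv, hw]

/-- An element of `SU(V, h)` that is diagonal on the first three vectors of a frame is diagonal,
with determinant one. -/
theorem exists_diagonal {a b v w : V} (f : D.Frame a b v w)
    {γ : V ≃ₗ[F] V} (hγ : γ ∈ D.SU) {p q r : F} (ha : γ a = p • a)
    (hb : γ b = q • b) (hv : γ v = r • v) : ∃ s : F, γ w = s • w ∧ p * q * r * s = 1 := by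
  have key : ∀ {x : V} {m : F}, x ≠ 0 → γ x = m • x → D.h x w = 0 → D.h x (γ w) = 0 := by
    intro x m hx hm hxw
    have h1 := hγ.2 x w
    rw [hm, hxw] at h1
    have hm0 : m ≠ 0 := by
      rintro rfl
      rw [zero_smul] at hm
      exact hx (γ.map_eq_zero_iff.1 hm)
    simpa [hm0] using h1
  have hb0 : b ≠ 0 := by rintro rfl; simpa using f.ab
  have hv0 : v ≠ 0 := by rintro rfl; simpa using f.vv
  have hw : γ w = (D.h w (γ w) / D.h w w) • w := by
    conv_lhs => rw [f.eq_sum (γ w), key f.left_ne_zero ha f.aw, key hb0 hb f.bw, key hv0 hv f.vw]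
    simp
  refine ⟨_, hw, ?_⟩
  have hdet := f.basis.det_comp (γ : V →ₗ[F] V) ![a, b, v, w]
  have hone : f.basis.det ![a, b, v, w] = 1 := by rw [← f.coe_basis, Basis.det_self]
  have hcomp : (γ : V →ₗ[F] V) ∘ ![a, b, v, w] =
      fun i => ![p, q, r, D.h w (γ w) / D.h w w] i • ![a, b, v, w] i := by
    ext i
    fin_cases i
    exacts [ha, hb, hv, hw]
  rw [hcomp, AlternatingMap.map_smul_univ, hγ.1, hone, Fin.prod_univ_four] at hdet
  simpa using hdet

/-- The torus element of a frame as an element of the transvection group. -/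
theorem exists_torus {a b v w : V} (f : D.Frame a b v w)
    [NeZero (2 : F)] (hσ : D.σ ≠ RingHom.id F) {l : F} (hl : l ≠ 0) :
    ∃ t ∈ D.transvectionGroup ⊤, t a = l • a ∧ t b = (D.σ l)⁻¹ • b ∧ t v = (D.σ l / l) • v ∧
      t w = w := by
  let X : Submodule F V := LinearMap.ker (D.h w)
  have hX : ∀ {x}, D.h w x = 0 → x ∈ X := fun h => h
  obtain ⟨t, ht, hta, htb⟩ := HermitianFourSpace.exists_torus hσ (hX (D.h_symm_zero f.aw))
    (hX (D.h_symm_zero f.bw)) (hX (D.h_symm_zero f.vw)) f.aa f.bb f.ab f.av f.bv f.vv hl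
  have htw : t w = w := transvectionGroup_apply_eq_self ht fun x hx => D.h_symm_zero hx
  -- The scalar on v is forced by determinant one.
  obtain ⟨s, hs, hs'⟩ := f.swap.exists_diagonal (transvectionGroup_le_SU ht) hta htb
    (htw.trans (one_smul F w).symm)
  refine ⟨t, transvectionGroup_mono le_top ht, hta, htb, ?_, htw⟩
  rw [hs]
  congr 1
  have hσl : D.σ l ≠ 0 := by simpa using hl
  field_simp at hs' ⊢
  linear_combination hs'

end Frame

/-- The case v = 0 imposes no orthogonality; the quotient by h(v,v) = 0 is then 0, so one formula
serves both cases. -/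
theorem exists_opposite [NeZero (2 : F)] {a v : V} (ha : a ≠ 0) (haa : D.h a a = 0)
    (hav : D.h a v = 0) (hv : D.h v v ≠ 0 ∨ v = 0) :
    ∃ b, D.h b b = 0 ∧ D.h a b = 1 ∧ D.h b v = 0 := by
  have h2 : (2 : F) ≠ 0 := NeZero.ne 2
  obtain ⟨x, hx⟩ := D.exists_h_eq_one ha
  obtain ⟨y, hy⟩ : ∃ y, y = x - (D.h v x / D.h v v) • v := ⟨_, rfl⟩
  have hay : D.h a y = 1 := by simp [hy, hx, hav]
  have hvy : D.h v y = 0 := by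
    rcases hv with hv | rfl
    · simp [hy, hv]
    · simp
  refine ⟨y - (D.h y y / 2) • a, ?_, by simp [hay, haa], ?_⟩
  · simp only [map_sub, map_smulₛₗ, LinearMap.sub_apply, LinearMap.smul_apply, smul_eq_mul, haa,
      hay, D.h_symm_one hay, map_div₀, map_ofNat, ← D.hermitian y y, RingHom.id_apply]
    field_simp
    ring
  · simp [D.h_symm_zero hvy, hav]

theorem exists_orthogonal (a b v : V) : ∃ w : V, w ≠ 0 ∧ D.h a w = 0 ∧ D.h b w = 0 ∧
    D.h v w = 0 := by
  have : Module.Finite F V := Module.Finite.of_basis D.e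
  have hlt : finrank F (Fin 3 → F) < finrank F V := by
    rw [D.finrank_eq_four, finrank_fin_fun]
    norm_num
  have hker := LinearMap.ker_ne_bot_of_finrank_lt (f := LinearMap.pi ![D.h a, D.h b, D.h v]) hlt
  obtain ⟨w, hw, hw0⟩ := Submodule.exists_mem_ne_zero_of_ne_bot hker
  rw [LinearMap.mem_ker] at hw
  exact ⟨w, hw0, congrFun hw 0, congrFun hw 1, congrFun hw 2⟩

theorem h_self_ne_zero_of_orthogonal (hsplit : ¬ D.IsSplit) {a b v : V} (ha : a ≠ 0)
    (haa : D.h a a = 0) (hab : D.h a b = 1) (hav : D.h a v = 0) (hbv : D.h b v = 0)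
    (hv : v ≠ 0) : D.h v v ≠ 0 := by
  intro hvv
  obtain ⟨m, rfl⟩ := D.exists_smul_eq_of_isotropic hsplit ha haa hvv hav
  rw [map_smul, D.h_symm_one hab, smul_eq_mul, mul_one] at hbv
  simp [hbv] at hv

theorem exists_frame_of_three (hsplit : ¬ D.IsSplit) {a b v : V}
    (haa : D.h a a = 0) (hbb : D.h b b = 0) (hab : D.h a b = 1) (hav : D.h a v = 0)
    (hbv : D.h b v = 0) (hv : v ≠ 0) : ∃ w, D.Frame a b v w := by
  have ha : a ≠ 0 := by rintro rfl; simp at hab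
  obtain ⟨w, hw, haw, hbw, hvw⟩ := D.exists_orthogonal a b v
  exact ⟨w, haa, hbb, hab, hav, haw, hbv, hbw, hvw,
    h_self_ne_zero_of_orthogonal hsplit ha haa hab hav hbv hv,
    h_self_ne_zero_of_orthogonal hsplit ha haa hab haw hbw hw⟩

theorem exists_frame_of_pair (hsplit : ¬ D.IsSplit) [NeZero (2 : F)] {a v : V} (ha : a ≠ 0)
    (haa : D.h a a = 0) (hav : D.h a v = 0) (hv : D.h v v ≠ 0) :
    ∃ b w, D.Frame a b v w := by
  obtain ⟨b, hbb, hab, hbv⟩ := exists_opposite ha haa hav (Or.inl hv)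
  obtain ⟨w, hw⟩ := exists_frame_of_three hsplit haa hbb hab hav hbv
    (by rintro rfl; simp at hv)
  exact ⟨b, w, hw⟩

theorem exists_frame (hsplit : ¬ D.IsSplit) [NeZero (2 : F)] {a : V} (ha : a ≠ 0)
    (haa : D.h a a = 0) : ∃ b v w, D.Frame a b v w := by
  obtain ⟨b, hbb, hab, -⟩ := exists_opposite (v := 0) ha haa (by simp) (Or.inr rfl)
  obtain ⟨v, hv, hav, hbv, -⟩ := D.exists_orthogonal a b 0
  obtain ⟨w, hw⟩ := exists_frame_of_three hsplit haa hbb hab hav hbv hv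
  exact ⟨b, v, w, hw⟩

/-- On the anisotropic plane orthogonal to a, b, a torus element is a quasi-reflection. One along n
= γv - v carries v to γv; another, along w with the same l, cancels its effect on a and b.
Determinant one settles w. -/
theorem mem_transvectionGroup_of_fix_pair (hσ : D.σ ≠ RingHom.id F) (hsplit : ¬ D.IsSplit)
    [NeZero (2 : F)] {a b v w : V} (f : D.Frame a b v w) {γ : V ≃ₗ[F] V} (hγ : γ ∈ D.SU)
    (hγa : γ a = a) (hγb : γ b = b) : γ ∈ D.transvectionGroup ⊤ := by
  obtain ⟨n, hn⟩ : ∃ n, n = γ v - v := ⟨_, rfl⟩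
  by_cases hn0 : n = 0
  · have hγv : γ v = v := sub_eq_zero.1 (hn.symm.trans hn0)
    obtain ⟨s, hs, hs1⟩ := f.exists_diagonal hγ (p := 1) (q := 1) (r := 1) (by simpa using hγa)
      (by simpa using hγb) (by simpa using hγv)
    have hone : γ = 1 := by
      refine f.ext_equiv hγa hγb hγv ?_
      rw [one_mul, one_mul, one_mul] at hs1
      rw [hs, hs1, one_smul]
      rfl
    rw [hone]
    exact one_mem _
  · have han : D.h a n = 0 := by
      have := hγ.2 a v
      rw [hγa, f.av] at this
      simp [hn, this, f.av]
    have hbn : D.h b n = 0 := by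
      have := hγ.2 b v
      rw [hγb, f.bv] at this
      simp [hn, this, f.bv]
    obtain ⟨n', f'⟩ := exists_frame_of_three hsplit f.aa f.bb f.ab han hbn hn0
    have hsum : D.h n n + D.h n v + D.σ (D.h n v) = 0 := by
      rw [← D.hermitian]
      simp only [hn, map_sub, LinearMap.sub_apply, hγ.2]
      ring
    have hnv : D.h n v ≠ 0 := by
      intro h0
      rw [h0] at hsum
      exact f'.vv (by simpa using hsum)
    obtain ⟨s, hs, hs0⟩ := exists_skew hσ
    -- Chosen so that σ(l)/l = -σ(h(n,v))/h(n,v), exactly the factor on n for which v goes to v + n.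
    obtain ⟨l, hl⟩ : ∃ l, l = s * D.h n v := ⟨_, rfl⟩
    have hl0 : l ≠ 0 := hl ▸ mul_ne_zero hs0 hnv
    obtain ⟨t, ht, hta, htb, htn, htn'⟩ := f'.exists_torus hσ hl0
    obtain ⟨t₂, ht₂, ht₂a, ht₂b, ht₂w, ht₂v⟩ := f.swap.exists_torus hσ hl0
    have htv : t v = γ v := by
      have hv := f'.eq_sum v
      rw [f.av, f.bv, zero_smul, zero_smul, zero_add, zero_add] at hv
      have hγv : γ v = v + n := by rw [hn]; abel
      have hz : D.σ l / l * (D.h n v / D.h n n) = D.h n v / D.h n n + 1 := by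
        have hnn := f'.vv
        rw [hl, map_mul, hs]
        field_simp
        linear_combination -hsum
      rw [hγv]
      conv_lhs => rw [hv]
      rw [map_add, map_smul, map_smul, htn, htn', smul_smul, mul_comm, hz, add_smul, one_smul,
        add_right_comm, ← hv]
    have hσl : D.σ l ≠ 0 := by simpa using hl0
    have hδa : t₂ (t⁻¹ (γ a)) = a := by
      have : t⁻¹ a = l⁻¹ • a := by
        rw [LinearEquiv.coe_inv, LinearEquiv.symm_apply_eq, map_smul, hta, smul_smul,
          inv_mul_cancel₀ hl0, one_smul]
      rw [hγa, this, map_smul, ht₂a, smul_smul, inv_mul_cancel₀ hl0, one_smul]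
    have hδb : t₂ (t⁻¹ (γ b)) = b := by
      have : t⁻¹ b = D.σ l • b := by
        rw [LinearEquiv.coe_inv, LinearEquiv.symm_apply_eq, map_smul, htb, smul_smul,
          mul_inv_cancel₀ hσl, one_smul]
      rw [hγb, this, map_smul, ht₂b, smul_smul, mul_inv_cancel₀ hσl, one_smul]
    have hδv : t₂ (t⁻¹ (γ v)) = v := by
      rw [← htv, LinearEquiv.coe_inv, LinearEquiv.symm_apply_apply, ht₂v]
    have hone : t₂ * (t⁻¹ * γ) = 1 := by
      have hSU : t₂ * (t⁻¹ * γ) ∈ D.SU := mul_mem (transvectionGroup_le_SU ht₂)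
        (mul_mem (inv_mem (transvectionGroup_le_SU ht)) hγ)
      obtain ⟨r, hr, hr1⟩ := f.exists_diagonal hSU (p := 1) (q := 1) (r := 1)
        (by simpa using hδa) (by simpa using hδb) (by simpa using hδv)
      refine f.ext_equiv hδa hδb hδv ?_
      rw [one_mul, one_mul, one_mul] at hr1
      rw [hr, hr1, one_smul]
      rfl
    have hγ' : γ = t * t₂⁻¹ := by
      rw [← mul_assoc, mul_eq_one_iff_inv_eq, mul_inv_rev, inv_inv] at hone
      exact hone.symm
    rw [hγ']
    exact mul_mem ht (inv_mem ht₂)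

/-- The special unitary group of Witt index one is generated by transvections. -/
theorem transvectionGroup_top_eq_SU (hσ : D.σ ≠ RingHom.id F) (hsplit : ¬ D.IsSplit)
    (hiso : D.IsIsotropic) [NeZero (2 : F)] : D.transvectionGroup ⊤ = D.SU := by
  refine le_antisymm transvectionGroup_le_SU fun γ hγ => ?_
  obtain ⟨a, ha, haa⟩ := hiso
  obtain ⟨b, v, w, f⟩ := exists_frame hsplit ha haa
  obtain ⟨s, hs, hs0⟩ := exists_skew hσ
  have hγa0 : γ a ≠ 0 := γ.map_ne_zero_iff.2 ha
  obtain ⟨t, ht, m, hm0, htm⟩ : ∃ t ∈ D.transvectionGroup ⊤, ∃ m : F, m ≠ 0 ∧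
      γ a = m • t a := by
    -- If γa is orthogonal to a, Witt index one makes it a multiple of a; otherwise a Weyl element
    -- moves the line of a to that of γa.
    by_cases hκ : D.h a (γ a) = 0
    · obtain ⟨m, hm⟩ := D.exists_smul_eq_of_isotropic hsplit ha haa
        (by rw [hγ.2, haa]) hκ
      refine ⟨1, one_mem _, m, ?_, hm⟩
      rintro rfl
      exact hγa0 (by simpa using hm)
    · obtain ⟨t, ht, h⟩ := exists_weyl_smul (X := ⊤) trivial trivial haa
        (by rw [hγ.2, haa]) hκ hs hs0
      refine ⟨t, ht, -(s * D.h a (γ a)), neg_ne_zero.2 (mul_ne_zero hs0 hκ), ?_⟩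
      rw [h, smul_smul, neg_mul_neg, mul_inv_cancel₀ (mul_ne_zero hs0 hκ), one_smul]
  obtain ⟨t₂, ht₂, ht₂a, -⟩ := f.exists_torus hσ hm0
  have htt : t * t₂ ∈ D.transvectionGroup ⊤ := mul_mem ht ht₂
  set γ₁ := (t * t₂)⁻¹ * γ with hγ₁
  have hγ₁SU : γ₁ ∈ D.SU := mul_mem (inv_mem (transvectionGroup_le_SU htt)) hγ
  have hγ₁a : γ₁ a = a := by
    rw [hγ₁, LinearEquiv.mul_apply, LinearEquiv.coe_inv, LinearEquiv.symm_apply_eq,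
      LinearEquiv.mul_apply, ht₂a, htm, map_smul]
  obtain ⟨n, hn, hna, hnb⟩ := exists_map_opposite (X := ⊤) hσ (a := a) (b := b) (c := γ₁ b)
    trivial trivial trivial haa f.bb (by rw [hγ₁SU.2, f.bb]) f.ab
    (by have := hγ₁SU.2 a b; rwa [hγ₁a, f.ab] at this)
  have hmem := mem_transvectionGroup_of_fix_pair hσ hsplit f
    (mul_mem (transvectionGroup_le_SU hn) hγ₁SU)
    (by rw [LinearEquiv.mul_apply, hγ₁a, hna]) (by rw [LinearEquiv.mul_apply, hnb])
  rw [Subgroup.mul_mem_cancel_left _ hn, hγ₁,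
    Subgroup.mul_mem_cancel_left _ (inv_mem htt)] at hmem
  exact hmem

end HermitianFourSpace

/-! ### Bivector calculus and exterior squares of transvections -/

namespace HermitianFourSpace

variable {F : Type u} {V : Type v} [Field F] [AddCommGroup V] [Module F V]
  {D : HermitianFourSpace F V}

/-- The bivector `x ∧ y`, bilinear in `x` and `y`. -/
def wedge (F : Type u) {V : Type v} [Field F] [AddCommGroup V] [Module F V] (x y : V) :
    ⋀[F]^2 V := exteriorPower.ιMulti F 2 ![x, y]

theorem wedge_coe (x y : V) : (wedge F x y : ExteriorAlgebra F V) =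
    ExteriorAlgebra.ι F x * ExteriorAlgebra.ι F y := by
  simp [wedge, ExteriorAlgebra.ιMulti_apply]

theorem wedge_add_left (x x' y : V) : wedge F (x + x') y = wedge F x y + wedge F x' y :=
  Subtype.ext (by simp [wedge_coe, add_mul])

theorem wedge_add_right (x y y' : V) : wedge F x (y + y') = wedge F x y + wedge F x y' :=
  Subtype.ext (by simp [wedge_coe, mul_add])

theorem wedge_smul_left (s : F) (x y : V) : wedge F (s • x) y = s • wedge F x y :=
  Subtype.ext (by simp [wedge_coe])

theorem wedge_smul_right (s : F) (x y : V) : wedge F x (s • y) = s • wedge F x y :=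
  Subtype.ext (by simp [wedge_coe])

theorem wedge_self (x : V) : wedge F x x = 0 :=
  Subtype.ext (by simp [wedge_coe])

theorem wedge_swap (x y : V) : wedge F y x = -wedge F x y :=
  Subtype.ext (by
    simp only [wedge_coe, NegMemClass.coe_neg]
    exact eq_neg_of_add_eq_zero_left (ExteriorAlgebra.ι_add_mul_swap y x))

theorem map_wedge (f : V →ₗ[F] V) (x y : V) :
    exteriorPower.map 2 f (wedge F x y) = wedge F (f x) (f y) := by
  rw [wedge, exteriorPower.map_apply_ιMulti, wedge]
  congr 1
  ext k; fin_cases k <;> rfl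

theorem extH_wedge (x y z t : V) :
    D.extH (wedge F x y) (wedge F z t) = D.h x z * D.h y t - D.h x t * D.h y z :=
  D.extH_ιMulti x y z t

theorem pf_wedge (x y z t : V) :
    D.pf (wedge F x y) (wedge F z t) = D.volume * D.e.det ![x, y, z, t] :=
  D.pf_ιMulti x y z t

theorem pf_wedge_left_left (x y t : V) : D.pf (wedge F x y) (wedge F x t) = 0 := by
  rw [pf_wedge, AlternatingMap.map_eq_zero_of_eq (i := 0) (j := 2) _ _ rfl (by decide), mul_zero]

theorem pf_wedge_left_right (x y t : V) : D.pf (wedge F x y) (wedge F t x) = 0 := by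
  rw [pf_wedge, AlternatingMap.map_eq_zero_of_eq (i := 0) (j := 3) _ _ rfl (by decide), mul_zero]

theorem pf_wedge_right_left (x y t : V) : D.pf (wedge F x y) (wedge F y t) = 0 := by
  rw [pf_wedge, AlternatingMap.map_eq_zero_of_eq (i := 1) (j := 2) _ _ rfl (by decide), mul_zero]

theorem pf_wedge_right_right (x y t : V) : D.pf (wedge F x y) (wedge F t y) = 0 := by
  rw [pf_wedge, AlternatingMap.map_eq_zero_of_eq (i := 1) (j := 3) _ _ rfl (by decide), mul_zero]

theorem pf_wedge_exchange (x y z t : V) :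
    D.pf (wedge F x z) (wedge F y t) = -D.pf (wedge F x y) (wedge F z t) := by
  rw [pf_wedge, pf_wedge, ← mul_neg, ← D.e.det.map_swap ![x, y, z, t] (i := 1) (j := 2) (by decide)]
  congr 2
  ext k; fin_cases k <;> rfl

theorem pf_wedge_comm (x y z t : V) :
    D.pf (wedge F z t) (wedge F x y) = D.pf (wedge F x y) (wedge F z t) := by
  rw [pf_wedge_exchange, wedge_swap x z, wedge_swap y t, map_neg, map_neg, LinearMap.neg_apply,
    pf_wedge_exchange]
  simp

theorem volume_withBasis {x y z t : V} (hx : LinearIndependent F ![x, y, z, t]) :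
    (D.withBasis (D.basisOfFour hx)).volume = D.pf (wedge F x y) (wedge F z t) := by
  have h : (D.basisOfFour hx).det ![x, y, z, t] = 1 :=
    (congrArg _ (D.coe_basisOfFour hx).symm).trans (Basis.det_self _)
  have h' := (D.withBasis (D.basisOfFour hx)).pf_ιMulti x y z t
  change _ = _ * (D.basisOfFour hx).det _ at h'
  rw [h, mul_one] at h'
  exact h'.symm

theorem pf_ne_zero_of_linearIndependent {x y z t : V}
    (hx : LinearIndependent F ![x, y, z, t]) : D.pf (wedge F x y) (wedge F z t) ≠ 0 := by
  rw [← volume_withBasis hx]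
  exact volume_ne_zero _

theorem pf_smul_eq {x y z t : V} (hx : LinearIndependent F ![x, y, z, t]) (q : ⋀[F]^2 V) :
    D.pf (wedge F x y) (wedge F z t) • q =
      D.pf q (wedge F z t) • wedge F x y - D.pf q (wedge F y t) • wedge F x z
      + D.pf q (wedge F y z) • wedge F x t + D.pf q (wedge F x t) • wedge F y z
      - D.pf q (wedge F x z) • wedge F y t + D.pf q (wedge F x y) • wedge F z t := by
  have h := (D.withBasis (D.basisOfFour hx)).volume_smul q
  have hb : ∀ i k, (D.withBasis (D.basisOfFour hx)).bivector i k =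
      wedge F (![x, y, z, t] i) (![x, y, z, t] k) := fun i k =>
    congrArg (fun e : Fin 4 → V => wedge F (e i) (e k)) (D.coe_basisOfFour hx)
  rw [volume_withBasis] at h
  simp only [hb] at h
  exact h

theorem linearMap_ext_wedge {M : Type*} [AddCommGroup M] [Module F M] (D : HermitianFourSpace F V)
    {x y z t : V} (hx : LinearIndependent F ![x, y, z, t]) {S T : ⋀[F]^2 V →ₗ[F] M}
    (h₁ : S (wedge F x y) = T (wedge F x y)) (h₂ : S (wedge F x z) = T (wedge F x z))
    (h₃ : S (wedge F x t) = T (wedge F x t)) (h₄ : S (wedge F y z) = T (wedge F y z))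
    (h₅ : S (wedge F y t) = T (wedge F y t)) (h₆ : S (wedge F z t) = T (wedge F z t)) :
    S = T := by
  refine LinearMap.ext fun q => ?_
  have hk := pf_ne_zero_of_linearIndependent (D := D) hx
  have key : D.pf (wedge F x y) (wedge F z t) • S q = D.pf (wedge F x y) (wedge F z t) • T q := by
    rw [← map_smul, ← map_smul, pf_smul_eq hx q]
    simp only [map_add, map_sub, map_smul, h₁, h₂, h₃, h₄, h₅, h₆]
  exact smul_right_injective M hk key

theorem g_apply_zero (x y : ⋀[F]^2 V) : (D.g x y).1 0 0 = D.extH x y := by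
  simp [g, ofF, j, mat]

theorem g_apply_one (x y : ⋀[F]^2 V) : (D.g x y).1 1 0 = D.pf x y := by
  simp [g, ofF, j, mat]

theorem op_g_smul (x y t : ⋀[F]^2 V) :
    MulOpposite.op (D.g x y) • t = D.extH x y • t + D.pf x y • D.J t := by
  rw [smul_def, g_apply_zero, g_apply_one]

theorem α_apply_zero (p : D.K) : (D.α p).1 0 0 = D.σ (p.1 0 0) := by
  simp [α, ofF, j, mat]

theorem α_apply_one (p : D.K) : (D.α p).1 1 0 = p.1 1 0 := by
  simp [α, ofF, j, mat]

theorem K_ext {k l : D.K} (h₀ : k.1 0 0 = l.1 0 0) (h₁ : k.1 1 0 = l.1 1 0) : k = l := by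
  apply Subtype.ext
  ext i m
  fin_cases i <;> fin_cases m
  · exact h₀
  · change k.1 0 1 = l.1 0 1
    rw [apply_zero_one, apply_zero_one, h₁]
  · exact h₁
  · change k.1 1 1 = l.1 1 1
    rw [apply_one_one, apply_one_one, h₀]

theorem apply_smul (T : ⋀[F]^2 V ≃ₗ[D.Kᵐᵒᵖ] ⋀[F]^2 V) (s : F) (x : ⋀[F]^2 V) :
    T (s • x) = s • T x := by
  have h : ∀ y : ⋀[F]^2 V, MulOpposite.op (D.ofF s) • y = s • y := fun y => by
    rw [smul_def]
    simp [ofF, mat]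
  rw [← h, T.map_smul, h]

/-- `J` is right multiplication by j; hence `K`-linear maps that agree at x agree at `J` x. -/
theorem apply_J (T : ⋀[F]^2 V ≃ₗ[D.Kᵐᵒᵖ] ⋀[F]^2 V) (x : ⋀[F]^2 V) :
    T (D.J x) = D.J (T x) := by
  have h : ∀ y : ⋀[F]^2 V, MulOpposite.op D.j • y = D.J y := fun y => by
    rw [smul_def]
    simp [j, mat]
  rw [← h, T.map_smul, h]

namespace Frame

theorem pf_table (D : HermitianFourSpace F V) (a b v w : V) :
    D.pf (wedge F a v) (wedge F b w) = -D.pf (wedge F a b) (wedge F v w) ∧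
    D.pf (wedge F a w) (wedge F b v) = D.pf (wedge F a b) (wedge F v w) ∧
    D.pf (wedge F v w) (wedge F a b) = D.pf (wedge F a b) (wedge F v w) := by
  have h₁ := D.pf_wedge_exchange a b v w
  have h₂ : D.pf (wedge F a w) (wedge F b v) = D.pf (wedge F a b) (wedge F v w) := by
    rw [pf_wedge_exchange, wedge_swap v w, map_neg, neg_neg]
  exact ⟨h₁, h₂, pf_wedge_comm _ _ _ _⟩

theorem volume_ne_zero {a b v w : V} (f : D.Frame a b v w) : D.pf (wedge F a b) (wedge F v w) ≠ 0 :=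
  pf_ne_zero_of_linearIndependent f.linearIndependent

theorem smul_J {a b v w : V} (f : D.Frame a b v w)
    (x : ⋀[F]^2 V) : D.pf (wedge F a b) (wedge F v w) • D.J x =
    D.extH x (wedge F v w) • wedge F a b - D.extH x (wedge F b w) • wedge F a v
      + D.extH x (wedge F b v) • wedge F a w + D.extH x (wedge F a w) • wedge F b v
      - D.extH x (wedge F a v) • wedge F b w + D.extH x (wedge F a b) • wedge F v w := by
  rw [pf_smul_eq f.linearIndependent (D.J x)]
  simp only [pf_J]

theorem J_av {a b v w : V} (f : D.Frame a b v w) : D.J (wedge F a v) =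
    (D.h v v / D.pf (wedge F a b) (wedge F v w)) • wedge F a w := by
  have h := f.smul_J (wedge F a v)
  simp only [extH_wedge, f.aa, f.ab, f.av, f.aw, f.vw, D.h_symm_zero f.av, D.h_symm_zero f.bv,
    mul_zero, zero_mul, one_mul, sub_zero, zero_smul, zero_add, add_zero] at h
  rw [div_eq_inv_mul, mul_smul, ← h, inv_smul_smul₀ f.volume_ne_zero]

theorem J_ab {a b v w : V} (f : D.Frame a b v w) : D.J (wedge F a b) =
    (-1 / D.pf (wedge F a b) (wedge F v w)) • wedge F v w := by
  have h := f.smul_J (wedge F a b)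
  simp only [extH_wedge, f.aa, f.ab, f.av, f.aw, f.bb, f.bv, f.bw, D.h_symm_one f.ab,
    mul_zero, mul_one, sub_zero, zero_smul, zero_add, add_zero, zero_sub] at h
  rw [div_eq_inv_mul, mul_smul, ← h, inv_smul_smul₀ f.volume_ne_zero]

theorem J_bv {a b v w : V} (f : D.Frame a b v w) : D.J (wedge F b v) =
    (-D.h v v / D.pf (wedge F a b) (wedge F v w)) • wedge F b w := by
  have h := f.smul_J (wedge F b v)
  simp only [extH_wedge, f.bb, f.vw, f.bv, f.bw, D.h_symm_one f.ab, D.h_symm_zero f.av,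
    D.h_symm_zero f.bv, mul_zero, zero_mul, one_mul, sub_zero, zero_smul, add_zero, zero_sub] at h
  rw [div_eq_inv_mul, mul_smul, neg_smul, ← h, inv_smul_smul₀ f.volume_ne_zero]

/-- The exterior square of a unitary transvection is an isotropic transvection of `g`. -/
theorem isEichlerWith_transvection {a b v w : V} (f : D.Frame a b v w)
    {s : F} (hs : D.σ s = -s) (τ : D.SU)
    (hτ : τ.1 = D.unitaryTransvection f.aa s) :
    D.IsEichlerWith (D.η τ) (wedge F a v) 0 (D.ofF (-s / D.h v v)) := by
  have hvv : D.σ (D.h v v) = D.h v v := (D.hermitian v v).symm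
  refine ⟨K_ext ?_ ?_, ?_, K_ext ?_ ?_, ?_⟩
  · rw [g_apply_zero, extH_wedge, f.aa, f.av]; simp
  · rw [g_apply_one, pf_wedge_left_left]; rfl
  · exact K_ext (by rw [g_apply_zero]; simp) (by rw [g_apply_one]; simp)
  · rw [g_apply_zero]
    simp only [Subring.coe_add, Matrix.add_apply, α_apply_zero]
    simp [ofF, mat, hs, hvv, neg_div]
  · rw [g_apply_one]
    simp only [Subring.coe_add, Matrix.add_apply, α_apply_one]
    simp [ofF, mat]
  · obtain ⟨k1, -, -⟩ := pf_table D a b v w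
    set k := D.pf (wedge F a b) (wedge F v w) with hk
    have hk0 : k ≠ 0 := f.volume_ne_zero
    have hp : MulOpposite.op (D.ofF (-s / D.h v v)) • wedge F a v =
        (-s / D.h v v) • wedge F a v := by
      rw [smul_def]; simp [ofF, mat]
    -- The last term is the j-part of Σ_{z,0,p}: `J` is semilinear, so it turns zp into (s/k)·a∧w.
    -- Both sides are linear and are compared on the six bivectors of the frame.
    have key : exteriorPower.map 2 (τ.1 : V →ₗ[F] V) = LinearMap.id
        - (D.extH (wedge F a v)).smulRight ((-s / D.h v v) • wedge F a v)
        - (D.pf (wedge F a v)).smulRight ((s / k) • wedge F a w) := by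
      have ta : τ.1 a = a := by rw [hτ, unitaryTransvection_apply, f.aa]; simp
      have tb : τ.1 b = b + s • a := by rw [hτ, unitaryTransvection_apply, f.ab, mul_one]
      have tv : τ.1 v = v := by rw [hτ, unitaryTransvection_apply, f.av]; simp
      have tw : τ.1 w = w := by rw [hτ, unitaryTransvection_apply, f.aw]; simp
      have hv0 := f.vv
      apply D.linearMap_ext_wedge f.linearIndependent <;>
      · simp only [map_wedge, LinearEquiv.coe_coe, ta, tb, tv, tw, LinearMap.sub_apply,
          LinearMap.id_apply, LinearMap.smulRight_apply, extH_wedge, f.aa, f.ab, f.av, f.aw, f.vw,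
          D.h_symm_zero f.av, D.h_symm_zero f.bv, pf_wedge_left_left,
          pf_wedge_right_left, pf_wedge_right_right, k1, wedge_add_left, wedge_add_right,
          wedge_smul_left, wedge_smul_right, wedge_self]
        match_scalars <;> field_simp <;> ring
    intro x
    have hx : (D.η τ).1 x = exteriorPower.map 2 (τ.1 : V →ₗ[F] V) x := rfl
    rw [hx, key, op_g_smul, op_g_smul, hp, zero_add, map_smulₛₗ, f.J_av]
    simp only [LinearMap.sub_apply, LinearMap.id_apply, LinearMap.smulRight_apply, map_zero,
      LinearMap.zero_apply, map_div₀, map_neg, hs, hvv, ← hk, neg_neg, smul_smul]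
    have hv0 := f.vv
    match_scalars <;> field_simp <;> ring

end Frame

end HermitianFourSpace

/-! ### Lifting Eichler transformations from (⋀²V,g) to (V,h) -/

namespace HermitianFourSpace

variable {F : Type u} {V : Type v} [Field F] [AddCommGroup V] [Module F V]
  {D : HermitianFourSpace F V}

variable (D) in
/-- The map `x ↦ x + (y + a r) h(a, x) - a h(y, x)`. -/
def eichlerMap (a y : V) (r : F) : V →ₗ[F] V :=
  LinearMap.id + (D.h a).smulRight (y + r • a) - (D.h y).smulRight a

theorem eichlerMap_apply (a y : V) (r : F) (x : V) :
    D.eichlerMap a y r x = x + D.h a x • (y + r • a) - D.h y x • a := rfl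

theorem eichlerMap_eichlerMap_neg {a y : V} (haa : D.h a a = 0) (hay : D.h a y = 0) {r r' : F}
    (hr : r + r' = -D.h y y) (x : V) :
    D.eichlerMap a y r (D.eichlerMap a (-y) r' x) = x := by
  simp only [eichlerMap_apply, map_add, map_sub, map_smul, map_neg, LinearMap.neg_apply,
    haa, hay, D.h_symm_zero hay]
  match_scalars
  · ring
  · ring
  · linear_combination D.h a x * hr

variable (D) in
/-- The Eichler transformation of `(V, h)` along an isotropic vector `a`. -/
def eichlerEquiv {a y : V} (haa : D.h a a = 0) (hay : D.h a y = 0) {r : F}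
    (hr : r + D.σ r = -D.h y y) : V ≃ₗ[F] V :=
  LinearEquiv.ofLinearMap (D.eichlerMap a y r) (D.eichlerMap a (-y) (D.σ r))
    (LinearMap.ext fun x => eichlerMap_eichlerMap_neg haa hay hr x)
    (LinearMap.ext fun x => by
      have := eichlerMap_eichlerMap_neg (y := -y) haa (by simp [hay]) (r := D.σ r) (r' := r)
        (by simpa [add_comm] using hr) x
      rwa [neg_neg] at this)

theorem eichlerEquiv_apply {a y : V} (haa : D.h a a = 0) (hay : D.h a y = 0) {r : F}
    (hr : r + D.σ r = -D.h y y) (x : V) :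
    D.eichlerEquiv haa hay hr x = x + D.h a x • (y + r • a) - D.h y x • a := rfl

theorem Frame.eichlerEquiv_mem_SU {a b v w : V} (f : D.Frame a b v w) {p q r : F}
    (hay : D.h a (p • v + q • w) = 0)
    (hr : r + D.σ r = -D.h (p • v + q • w) (p • v + q • w)) :
    D.eichlerEquiv f.aa hay hr ∈ D.SU := by
  refine ⟨?_, fun x y => ?_⟩
  · have hE := D.eichlerEquiv_apply f.aa hay hr
    have hdet := f.basis.det_comp (D.eichlerEquiv f.aa hay hr : V →ₗ[F] V) ![a, b, v, w]
    have hone : f.basis.det ![a, b, v, w] = 1 := by rw [← f.coe_basis, Basis.det_self]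
    rw [hone, mul_one] at hdet
    rw [← hdet]
    have ra : f.basis.repr a = Finsupp.single 0 1 := by
      rw [← f.basis.repr_self, f.coe_basis]; rfl
    have rb : f.basis.repr b = Finsupp.single 1 1 := by
      rw [← f.basis.repr_self, f.coe_basis]; rfl
    have rv : f.basis.repr v = Finsupp.single 2 1 := by
      rw [← f.basis.repr_self, f.coe_basis]; rfl
    have hrw : f.basis.repr w = Finsupp.single 3 1 := by
      rw [← f.basis.repr_self, f.coe_basis]; rfl
    simp [Basis.det_apply, Matrix.det_succ_row_zero, Fin.sum_univ_succ, Basis.toMatrix_apply,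
      Fin.succAbove, hE, ra, rb, rv, hrw, f.aa, f.ab, f.av, f.aw, D.h_symm_zero f.av,
      D.h_symm_zero f.aw]
  · have hya := D.h_symm_zero hay
    simp only [eichlerEquiv_apply]
    generalize p • v + q • w = z at *
    simp only [map_add, map_sub, map_smulₛₗ, LinearMap.add_apply,
      LinearMap.sub_apply, LinearMap.smul_apply, smul_eq_mul, f.aa, hay, hya,
      RingHom.id_apply, ← D.hermitian]
    linear_combination D.h x a * D.h a y * hr

/-- Every Eichler transformation `Σ_{z,w,p}` with `z = a ∧ v` comes from an Eichler transformation
of `(V, h)` along `a`. -/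
theorem Frame.mem_range_of_isEichlerWith [NeZero (2 : F)] {a b v w : V} (f : D.Frame a b v w)
    {T : D.U} {W : ⋀[F]^2 V} {p : D.K} (hT : D.IsEichlerWith T (wedge F a v) W p) :
    T ∈ D.η.range := by
  have h2 : (2 : F) ≠ 0 := NeZero.ne 2
  obtain ⟨-, hzW, hp, hT⟩ := hT
  obtain ⟨k1, k2, k5⟩ := Frame.pf_table D a b v w
  have hJav := f.J_av
  have hJab := f.J_ab
  have hJbv := f.J_bv
  have hk0 := f.volume_ne_zero
  have hW := pf_smul_eq (D := D) f.linearIndependent W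
  set k := D.pf (wedge F a b) (wedge F v w) with hk
  have hv0 := f.vv
  have hvv : D.σ (D.h v v) = D.h v v := (D.hermitian v v).symm
  obtain ⟨w₁, w₂, m, n, q₁, q₂, hW⟩ : ∃ w₁ w₂ m n q₁ q₂ : F, W = w₁ • wedge F a v +
      w₂ • wedge F a w + m • wedge F a b + n • wedge F v w + q₁ • wedge F b v +
      q₂ • wedge F b w := by
    refine ⟨k⁻¹ * -D.pf W (wedge F b w), k⁻¹ * D.pf W (wedge F b v), k⁻¹ * D.pf W (wedge F v w),
      k⁻¹ * D.pf W (wedge F a b), k⁻¹ * D.pf W (wedge F a w), k⁻¹ * -D.pf W (wedge F a v), ?_⟩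
    apply smul_right_injective _ hk0
    simp only [hW]
    match_scalars <;> field_simp
  have hpf0 : D.pf (wedge F a v) W = 0 := by
    rw [← g_apply_one, hzW]; rfl
  have hext0 : D.extH (wedge F a v) W = 0 := by
    rw [← g_apply_zero, hzW]; rfl
  -- The two components of g(z,W) = 0 kill the coefficients of b∧w and b∧v.
  have hq₂ : q₂ = 0 := by
    simpa [hW, pf_wedge_left_left, pf_wedge_right_left, pf_wedge_right_right, k1, hk0] using hpf0
  have hq₁ : q₁ = 0 := by
    simpa [hW, extH_wedge, f.aa, f.av, f.aw, f.ab, hv0, f.vw, D.h_symm_zero f.bv,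
      D.h_symm_zero f.av]
      using hext0
  rw [hq₁, hq₂, zero_smul, zero_smul, add_zero, add_zero] at hW
  have hp₀ : D.σ (p.1 0 0) + p.1 0 0 = D.extH W W := by
    rw [← g_apply_zero, ← hp, ← α_apply_zero]; rfl
  have hp₁ : p.1 1 0 + p.1 1 0 = D.pf W W := by
    rw [← g_apply_one, ← hp]
    nth_rewrite 1 [← α_apply_one]
    rfl
  have hpz := D.smul_def p (wedge F a v)
  generalize p.1 0 0 = p₀ at hp₀ hpz
  generalize p.1 1 0 = p₁ at hp₁ hpz
  have hp₀' : D.σ p₀ + p₀ = n * D.σ n * (D.h v v * D.h w w) - m * D.σ m := by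
    rw [hp₀, hW]
    simp only [map_add, map_smulₛₗ, LinearMap.add_apply, LinearMap.smul_apply, smul_eq_mul,
      extH_wedge, f.aa, f.bb, f.ab, f.av, f.aw, f.bv, f.bw, f.vw, D.h_symm_one f.ab,
      D.h_symm_zero f.av, D.h_symm_zero f.aw, D.h_symm_zero f.bv, D.h_symm_zero f.bw,
      D.h_symm_zero f.vw, RingHom.id_apply]
    ring
  have hp₁' : p₁ = m * n * k := by
    apply mul_left_cancel₀ h2
    rw [two_mul, hp₁, hW]
    simp only [map_add, map_smul, LinearMap.add_apply, LinearMap.smul_apply, smul_eq_mul,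
      pf_wedge_left_left, pf_wedge_left_right, pf_wedge_right_left, pf_wedge_right_right, k5, ← hk]
    ring
  -- The lift E is forced: T(a∧b) = a∧(b + y) gives y = -σ(m)v + n·h(v,v)w, and the a∧v coefficient
  -- of T(b∧v) gives r. The isometry condition on r is then the F-part of α(p) + p = g(W,W).
  have hay : D.h a (-D.σ m • v + (n * D.h v v) • w) = 0 := by simp [f.av, f.aw]
  obtain ⟨r, hr⟩ : ∃ r, r = D.h v v * (D.σ w₁ - w₁ - p₀) - D.σ m * m * D.h v v := ⟨_, rfl⟩
  have hrr : r + D.σ r = -D.h (-D.σ m • v + (n * D.h v v) • w)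
      (-D.σ m • v + (n * D.h v v) • w) := by
    simp only [hr, map_add, map_smulₛₗ, LinearMap.add_apply, LinearMap.smul_apply, smul_eq_mul,
      f.vw, D.h_symm_zero f.vw, RingHom.id_apply, map_sub, map_mul, map_neg, D.σ_σ, hvv]
    linear_combination (-D.h v v) * hp₀'
  have hE := D.eichlerEquiv_apply f.aa hay hrr
  have hSU := f.eichlerEquiv_mem_SU hay hrr
  generalize D.eichlerEquiv f.aa hay hrr = E at hE hSU
  have hEa : E a = a := by
    rw [hE]
    simp [f.aa, D.h_symm_zero f.av, D.h_symm_zero f.aw]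
  have hEb : E b = b + (-D.σ m • v + (n * D.h v v) • w + r • a) := by
    rw [hE]
    simp [f.ab, D.h_symm_zero f.bv, D.h_symm_zero f.bw]
  have hEv : E v = v + (m * D.h v v) • a := by
    rw [hE]
    simp [f.av, D.h_symm_zero f.vw, D.σ_σ]
  let S : ⋀[F]^2 V →ₗ[F] ⋀[F]^2 V :=
    { toFun := T.1, map_add' := map_add T.1, map_smul' := apply_smul T.1 }
  have hS : ∀ x, S x = x + (D.extH W x • wedge F a v + D.pf W x • D.J (wedge F a v)) -
      (D.extH (wedge F a v) x • (W + (p₀ • wedge F a v + p₁ • D.J (wedge F a v))) +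
        D.pf (wedge F a v) x • D.J (W + (p₀ • wedge F a v + p₁ • D.J (wedge F a v)))) := by
    intro x
    rw [← hpz, ← op_g_smul, ← op_g_smul]
    exact hT x
  -- Both maps commute with `J`, which sends a∧v, a∧b, b∧v to multiples of a∧w, v∧w, b∧w, so three
  -- comparisons suffice.
  have hSJ : ∀ x, S x = exteriorPower.map 2 (E : V →ₗ[F] V) x →
      S (D.J x) = exteriorPower.map 2 (E : V →ₗ[F] V) (D.J x) := by
    intro x hx
    rw [← D.J_map hSU, ← hx]
    exact apply_J T.1 x
  have hSc : ∀ {x y : ⋀[F]^2 V} {c : F}, c ≠ 0 → D.J x = c • y →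
      S x = exteriorPower.map 2 (E : V →ₗ[F] V) x →
      S y = exteriorPower.map 2 (E : V →ₗ[F] V) y := by
    intro x y c hc hxy hx
    have h := hSJ x hx
    rw [hxy, map_smul, map_smul] at h
    exact smul_right_injective _ hc h
  have hav : S (wedge F a v) = exteriorPower.map 2 (E : V →ₗ[F] V) (wedge F a v) := by
    rw [hS, hW]
    simp only [map_wedge, LinearEquiv.coe_coe, hEa, hEv, wedge_add_right, wedge_smul_right,
      wedge_self, map_add, map_smulₛₗ, LinearMap.add_apply, LinearMap.smul_apply, smul_eq_mul,
      extH_wedge, f.aa, f.av, D.h_symm_zero f.vw, D.h_symm_zero f.aw, f.bv,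
      pf_wedge_left_left, pf_wedge_left_right]
    match_scalars <;> ring
  have hab : S (wedge F a b) = exteriorPower.map 2 (E : V →ₗ[F] V) (wedge F a b) := by
    rw [hS, hW, hJav]
    simp only [map_wedge, LinearEquiv.coe_coe, hEa, hEb, wedge_add_right, wedge_smul_right,
      wedge_self, map_add, map_smulₛₗ, LinearMap.add_apply, LinearMap.smul_apply, smul_eq_mul,
      extH_wedge, f.aa, f.ab, f.bb, D.h_symm_one f.ab, D.h_symm_zero f.av, D.h_symm_zero f.bv,
      D.h_symm_zero f.aw, D.h_symm_zero f.bw, k5, RingHom.id_apply,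
      pf_wedge_left_left]
    match_scalars <;> field_simp <;> ring
  have hbv : S (wedge F b v) = exteriorPower.map 2 (E : V →ₗ[F] V) (wedge F b v) := by
    rw [hS, hW, hJav, hp₁']
    simp only [map_wedge, LinearEquiv.coe_coe, hEb, hEv, hr, wedge_add_right, wedge_smul_right,
      wedge_add_left, wedge_smul_left, wedge_swap a b, wedge_swap a v, wedge_swap a w,
      wedge_swap v w, wedge_self, map_add, map_smulₛₗ, LinearMap.add_apply, LinearMap.smul_apply,
      smul_eq_mul, extH_wedge, f.ab, f.bb, f.av, f.bv, D.h_symm_zero f.bv, D.h_symm_zero f.vw,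
      D.h_symm_zero f.bw, k2, RingHom.id_apply,
      pf_wedge_left_right, pf_wedge_right_left, pf_wedge_right_right]
    match_scalars <;> field_simp <;> ring
  have haw := hSc (div_ne_zero hv0 hk0) hJav hav
  have hvw := hSc (div_ne_zero (neg_ne_zero.2 one_ne_zero) hk0) hJab hab
  have hbw := hSc (div_ne_zero (neg_ne_zero.2 hv0) hk0) hJbv hbv
  have key := D.linearMap_ext_wedge f.linearIndependent hab hav haw hbv hbw hvw
  refine ⟨⟨E, hSU⟩, Subtype.ext (LinearEquiv.ext fun x => ?_)⟩
  exact (LinearMap.congr_fun key x).symm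

/-! ### Isotropic vectors of g and the two inclusions -/

variable (D) in
/-- A bivector on a four-dimensional space with vanishing Pfaffian is decomposable. -/
theorem exists_eq_wedge [NeZero (2 : F)] {Z : ⋀[F]^2 V} (hZ : D.pf Z Z = 0) :
    ∃ x y, Z = wedge F x y := by
  have h2 : (2 : F) ≠ 0 := NeZero.ne 2
  by_cases hZ0 : Z = 0
  · exact ⟨0, 0, by rw [hZ0, wedge_self]⟩
  obtain ⟨i, j, hij, hne⟩ : ∃ i j, i ≠ j ∧ D.pf Z (wedge F (D.e i) (D.e j)) ≠ 0 := by
    by_contra! h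
    have hv := D.volume_smul Z
    have hb : ∀ i j, i ≠ j → D.pf Z (D.bivector i j) = 0 := h
    rw [hb 2 3 (by decide), hb 1 3 (by decide), hb 1 2 (by decide), hb 0 3 (by decide),
      hb 0 2 (by decide), hb 0 1 (by decide)] at hv
    simp [D.volume_ne_zero, hZ0] at hv
  -- Reordering the basis makes the coefficient A of x∧y nonzero.
  obtain ⟨π, hπi, hπj⟩ : ∃ π : Equiv.Perm (Fin 4), π 2 = i ∧ π 3 = j := by
    clear hne
    revert i j
    decide
  have hli : LinearIndependent F ![D.e (π 0), D.e (π 1), D.e i, D.e j] := by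
    have := D.e.linearIndependent.comp π π.injective
    convert this using 1
    ext k; fin_cases k <;> simp [hπi, hπj]
  generalize D.e (π 0) = x at hli
  generalize D.e (π 1) = y at hli
  generalize D.e i = z at hli hne
  generalize D.e j = t at hli hne
  have hk := pf_ne_zero_of_linearIndependent (D := D) hli
  have hexp := pf_smul_eq (D := D) hli Z
  have hrel := congrArg (D.pf Z) hexp
  rw [map_smul, hZ, smul_zero] at hrel
  simp only [map_add, map_sub, map_smul, smul_eq_mul] at hrel
  set k := D.pf (wedge F x y) (wedge F z t)
  generalize D.pf Z (wedge F z t) = A at *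
  generalize D.pf Z (wedge F y t) = B at *
  generalize D.pf Z (wedge F y z) = C at *
  generalize D.pf Z (wedge F x t) = G at *
  generalize D.pf Z (wedge F x z) = H at *
  generalize D.pf Z (wedge F x y) = L at *
  -- Pf(Z,Z) = 0 is twice the Plücker relation. The factors below are read off from the coefficients
  -- of kZ; their wedge matches A·kZ term by term, with the relation needed only at z∧t.
  have hplucker : A * L = B * H - C * G := by
    apply mul_left_cancel₀ h2
    linear_combination -hrel
  refine ⟨(k * A)⁻¹ • (A • x + (-G) • z + H • t), A • y + (-B) • z + C • t, ?_⟩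
  apply smul_right_injective _ (mul_ne_zero hk hne)
  simp only [wedge_smul_left]
  rw [smul_inv_smul₀ (mul_ne_zero hk hne), mul_comm, mul_smul, hexp]
  simp only [wedge_add_left, wedge_add_right, wedge_smul_left, wedge_smul_right, wedge_self,
    wedge_swap y z, wedge_swap y t, wedge_swap z t]
  match_scalars
  all_goals first | ring1 | linear_combination hplucker

/-- The isotropic vectors of `g` are the bivectors `a ∧ v` with `a` isotropic and `v` orthogonal
to `a`. -/
theorem exists_eq_wedge_of_isotropic [NeZero (2 : F)] {Z : ⋀[F]^2 V} (hZ : D.g Z Z = 0) :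
    ∃ a v, Z = wedge F a v ∧ D.h a a = 0 ∧ D.h a v = 0 := by
  have hpf : D.pf Z Z = 0 := by rw [← g_apply_one, hZ]; rfl
  have hext : D.extH Z Z = 0 := by rw [← g_apply_zero, hZ]; rfl
  obtain ⟨x, y, rfl⟩ := D.exists_eq_wedge hpf
  rw [extH_wedge, D.hermitian x y] at hext
  by_cases hxx : D.h x x = 0
  · refine ⟨x, y, rfl, hxx, ?_⟩
    simpa [hxx] using hext
  · have hxx' : D.σ (D.h x x) = D.h x x := (D.hermitian x x).symm
    -- The Gram determinant of x, y vanishes, so the component of y orthogonal to x is isotropic; it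
    -- spans the radical of the plane.
    refine ⟨y - (D.h x y / D.h x x) • x, -x, ?_, ?_, ?_⟩
    · rw [sub_eq_add_neg, ← neg_smul, ← neg_one_smul F x]
      simp only [wedge_add_left, wedge_smul_left, wedge_smul_right, wedge_self, wedge_swap x y]
      module
    · simp only [map_sub, map_smulₛₗ, LinearMap.sub_apply, LinearMap.smul_apply, smul_eq_mul,
        map_div₀, hxx', D.hermitian x y, RingHom.id_apply]
      field_simp
      linear_combination hext
    · simp only [map_sub, map_smulₛₗ, LinearMap.sub_apply, LinearMap.smul_apply, smul_eq_mul,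
        map_div₀, hxx', D.hermitian x y, map_neg]
      field_simp
      ring

theorem IsEichler.mem_range (hsplit : ¬ D.IsSplit) [NeZero (2 : F)] {T : D.U}
    (hT : D.IsEichler T) : T ∈ D.η.range := by
  obtain ⟨Z, W, p, hT⟩ := hT
  obtain ⟨a, v, rfl, haa, hav⟩ := exists_eq_wedge_of_isotropic hT.1
  by_cases hz : wedge F a v = 0
  · obtain ⟨-, -, -, hT⟩ := hT
    have hone : T = 1 := by
      refine Subtype.ext (LinearEquiv.ext fun x => ?_)
      rw [hT, hz, op_g_smul, op_g_smul]
      simp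
    rw [hone]
    exact one_mem _
  · have ha : a ≠ 0 := by
      rintro rfl
      exact hz (by simpa using wedge_smul_left (0 : F) 0 v)
    -- By Witt index one, an isotropic v orthogonal to a would be a multiple of a, giving a∧v = 0.
    have hvv : D.h v v ≠ 0 := by
      intro hvv
      obtain ⟨m, rfl⟩ := D.exists_smul_eq_of_isotropic hsplit ha haa hvv hav
      exact hz (by rw [wedge_smul_right, wedge_self, smul_zero])
    obtain ⟨b, w, f⟩ := exists_frame_of_pair hsplit ha haa hav hvv
    exact f.mem_range_of_isEichlerWith hT

theorem range_le_closure_isotropicTransvection (hσ : D.σ ≠ RingHom.id F) (hiso : D.IsIsotropic)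
    (hsplit : ¬ D.IsSplit) [NeZero (2 : F)] :
    D.η.range ≤ Subgroup.closure {T : D.U | D.IsIsotropicTransvection T} := by
  have hle : D.transvectionGroup ⊤ ≤
      ((Subgroup.closure {T : D.U | D.IsIsotropicTransvection T}).comap D.η).map
        D.SU.subtype := by
    rw [transvectionGroup, Subgroup.closure_le]
    rintro _ ⟨u, -, hu, s, hs, rfl⟩
    refine ⟨⟨_, D.unitaryTransvection_mem_SU hu hs⟩, ?_, rfl⟩
    by_cases hu0 : u = 0
    · have hone : (⟨_, D.unitaryTransvection_mem_SU hu hs⟩ : D.SU) = 1 := by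
        refine Subtype.ext (LinearEquiv.ext fun x => ?_)
        change D.unitaryTransvection hu s x = x
        rw [unitaryTransvection_apply]
        simp [hu0]
      rw [hone]
      exact one_mem _
    · obtain ⟨b, v, w, f⟩ := exists_frame hsplit hu0 hu
      exact Subgroup.subset_closure ⟨_, _, f.isEichlerWith_transvection hs _ rfl⟩
  rintro _ ⟨γ, rfl⟩
  obtain ⟨γ', hγ', h⟩ := hle ((transvectionGroup_top_eq_SU hσ hsplit hiso).ge γ.2)
  have : γ' = γ := Subtype.ext h
  rw [← this]
  exact hγ'

end HermitianFourSpace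
end

theorem mainTheorem7 {F : Type*} {V : Type*} [Field F] [AddCommGroup V] [Module F V]
    (D : HermitianFourSpace F V) (hchar : ringChar F ≠ 2) (hσ : D.σ ≠ RingHom.id F)
    (hiso : D.IsIsotropic) (hsplit : ¬ D.IsSplit) :
    D.η.range = D.EU ∧
      D.EU = Subgroup.closure {T : D.U | D.IsIsotropicTransvection T} := by
  have : NeZero (2 : F) := ⟨Ring.two_ne_zero hchar⟩
  have h₁ := HermitianFourSpace.range_le_closure_isotropicTransvection hσ hiso hsplit
  have h₂ : Subgroup.closure {T : D.U | D.IsIsotropicTransvection T} ≤ D.EU :=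
    Subgroup.closure_mono fun T ⟨z, p, hT⟩ => ⟨z, 0, p, hT⟩
  have h₃ : D.EU ≤ D.η.range := (Subgroup.closure_le _).2 fun T hT =>
    hT.mem_range hsplit
  exact ⟨le_antisymm (h₁.trans h₂) h₃, le_antisymm (h₃.trans h₁) h₂⟩
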